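/- Let $\mathcal P_n$ be the $n$-qubit Pauli group (generated by $iI$ and the $n$-fold tensor products of $I,X,Y,Z$). For an operator $E$ on $n$ qubits let $\operatorname{supp}(E)$ be the set of qubits on which $E$ acts nontrivially and $\operatorname{wt}(E)=|\operatorname{supp}(E)|$. For a subgroup $\mathcal S\le\mathcal P_n$ let $N(\mathcal S)$ denote the group of all elements of $\mathcal P_n$ that commute with every element of $\mathcal S$. Stabilizer codes. Let $\mathcal S\le\mathcal P_n$ be an abelian subgroup with $-I\notin\mathcal S$. It defines an $[[n,k,d]]$ stabilizer code $\mathcal C=\{|\psi\rangle\in(\mathbb C^2)^{\otimes n} : S|\psi\rangle=|\psi\rangle \text{ for all } S\in\mathcal S\}$ if $\dim\mathcal C=2^k$ and $d=\min\operatorname{wt}\bigl(N(\mathcal S)\setminus\langle\mathcal S,iI\rangle\bigr)$ (in particular this minimum exists). Correctable sets. A set $B$ of $b$ of the $n$ qubits is correctable for $\mathcal C$ if there is a quantum channel $\mathcal R$ on the $n$ qubits such that $\mathcal R\bigl(\operatorname{Tr}_B(|\psi\rangle\langle\psi|)\otimes I_B/2^b\bigr)=|\psi\rangle\langle\psi|$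 for every $|\psi\rangle\in\mathcal C$. Entanglement-assisted stabilizer codes. An $[[m,k,d;c]]$ entanglement-assisted stabilizer code on $m$ sender qubits is given by Pauli operators $\widetilde Z_1,\dots,\widetilde Z_{c+r},\widetilde X_1,\dots,\widetilde X_c\in\mathcal P_m$ with $m=k+r+c$, such that the $\widetilde Z_i$ commute with each other, the $\widetilde X_i$ commute with each other, $\widetilde X_i$ commutes with $\widetilde Z_j$ for $i\ne j$, and $\widetilde X_i$ anticommutes with $\widetilde Z_i$; the code, that is, the space of vectors in $(\mathbb C^2)^{\otimes(m+c)}$ (the sender's $m$ qubits and $c$ receiver qubits) fixed by the extended generators $\widetilde Z_i\otimes Z_i$ and $\widetilde X_i\otimes X_i$ ($1\le i\le c$) and $\widetilde Z_j\otimes I$ ($c<j\le c+r$), has dimension $2^k$; and $d=\min\operatorname{wt}\bigl(N(\mathcal S')\setminus\langle\mathcal S'_I,iI\rangle\bigr)$, where $\mathcal S'$ is the group generated by all $\widetilde Z_i,\widetilde X_i$ and $\mathcal S'_I=\langle\widetilde Z_{c+1},\dots,\widetilde Z_{c+r}\rangle$. (Here $c$ is the number of noiseless ebits shared by sender and receiver.)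 Corollary. Let $\mathcal C$ be an $[[n,k,d]]$ stabilizer code with stabilizer group $\mathcal S$, let $B$ be a correctable set of $b$ qubits for $\mathcal C$, and let $\mathcal S_B=\{S\in\mathcal S : \operatorname{supp}(S)\subseteq B\}$, with $|\mathcal S_B|=2^s$. Then $s\le b$, and there exists an entanglement-assisted stabilizer code with parameters $[[n-b,k,d;b-s]]$. -/

import Mathlib

noncomputable section

namespace EAQ

/-! ### Qubit registers and operators on them -/

/-- Computational basis labels of a register whose qubits are indexed by `ι`. -/
abbrev Label (ι : Type) := ι → Fin 2

/-- State vectors of the register, i.e. `(ℂ²)^{⊗ ι}` in the computational basis. -/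
abbrev State (ι : Type) := Label ι → ℂ

/-- Linear operators on the register. -/
abbrev Op (ι : Type) := Matrix (Label ι) (Label ι) ℂ

variable {ι κ : Type} [Fintype ι] [DecidableEq ι] [Fintype κ] [DecidableEq κ]

/-- The tensor product `⨂_j A_j` of one-qubit operators. -/
def tensorOp (A : ι → Matrix (Fin 2) (Fin 2) ℂ) : Op ι :=
  fun x y => ∏ j, A j (x j) (y j)

/-- The operator `E ⊗ F` on the union of two disjoint registers. -/
def tensorPair (E : Op ι) (F : Op κ) : Op (ι ⊕ κ) :=
  fun x y => E (fun i => x (Sum.inl i)) (fun i => y (Sum.inl i)) *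
    F (fun i => x (Sum.inr i)) (fun i => y (Sum.inr i))

/-- The one-qubit operator `A` applied to qubit `j`, with the identity on all other qubits. -/
def onQubit (j : ι) (A : Matrix (Fin 2) (Fin 2) ℂ) : Op ι :=
  tensorOp (Function.update (fun _ => 1) j A)

/-- `E` acts trivially on qubit `j`: it has the form `E' ⊗ I_j`. -/
def ActsTriviallyOn (E : Op ι) (j : ι) : Prop :=
  ∀ x y : Label ι, E x y =
    if x j = y j then E (Function.update x j 0) (Function.update y j 0) else 0

/-- The set of qubits on which `E` acts nontrivially. -/
def supp (E : Op ι) : Set ι := {j | ¬ ActsTriviallyOn E j}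

/-- The Hamming weight of an operator. -/
def weight (E : Op ι) : ℕ := (supp E).ncard

/-! ### The Pauli group -/

/-- The Pauli matrix `X`. -/
def pauliX : Matrix (Fin 2) (Fin 2) ℂ := !![0, 1; 1, 0]

/-- The Pauli matrix `Y`. -/
def pauliY : Matrix (Fin 2) (Fin 2) ℂ := !![0, -Complex.I; Complex.I, 0]

/-- The Pauli matrix `Z`. -/
def pauliZ : Matrix (Fin 2) (Fin 2) ℂ := !![1, 0; 0, -1]

variable (ι) in
/-- The scalar operator `iI`. -/
def phaseI : (Op ι)ˣ :=
  Units.map (algebraMap ℂ (Op ι)).toMonoidHom (Units.mk0 Complex.I Complex.I_ne_zero)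

variable (ι) in
/-- The Pauli group of the register, generated by `iI` and the tensor products of
`I, X, Y, Z`. -/
def pauliGroup : Subgroup (Op ι)ˣ :=
  Subgroup.closure ({phaseI ι} ∪
    {U | ∃ σ : ι → Matrix (Fin 2) (Fin 2) ℂ,
      (∀ j, σ j ∈ ({1, pauliX, pauliY, pauliZ} : Set (Matrix (Fin 2) (Fin 2) ℂ))) ∧
      (U : Op ι) = tensorOp σ})

/-- `N(S)`: the Pauli operators that commute with every element of `S`. -/
def pauliCentralizer (S : Subgroup (Op ι)ˣ) : Subgroup (Op ι)ˣ :=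
  pauliGroup ι ⊓ Subgroup.centralizer (S : Set (Op ι)ˣ)

/-- The elements of `N(S)` outside `⟨T, iI⟩`. -/
def nontrivialLogicals (S T : Subgroup (Op ι)ˣ) : Set (Op ι)ˣ :=
  {L | L ∈ pauliCentralizer S ∧ L ∉ T ⊔ Subgroup.zpowers (phaseI ι)}

/-! ### Stabilizer codes -/

/-- The subspace of the vectors fixed by all operators in `G`. -/
def fixedSpace (G : Set (Op ι)) : Submodule ℂ (State ι) where
  carrier := {ψ | ∀ g ∈ G, g.mulVec ψ = ψ}
  add_mem' := by
    intro ψ φ hψ hφ g hg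
    rw [Matrix.mulVec_add, hψ g hg, hφ g hg]
  zero_mem' := by
    intro g _
    exact Matrix.mulVec_zero g
  smul_mem' := by
    intro a ψ hψ g hg
    rw [Matrix.mulVec_smul, hψ g hg]

/-- The stabilizer code of `S`. -/
def codespace (S : Subgroup (Op ι)ˣ) : Submodule ℂ (State ι) :=
  fixedSpace ((fun U : (Op ι)ˣ => (U : Op ι)) '' (S : Set (Op ι)ˣ))

/-- `S` is a stabilizer group: an abelian subgroup of the Pauli group without `-I`. -/
structure IsStabilizerGroup (S : Subgroup (Op ι)ˣ) : Prop where
  le_pauli : S ≤ pauliGroup ι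
  comm : ∀ g ∈ S, ∀ h ∈ S, g * h = h * g
  neg_one_notMem : (-1 : (Op ι)ˣ) ∉ S

/-- `S` is the stabilizer group of an `[[n, k, d]]` stabilizer code, `n` being the number of
qubits in `ι`: the code has dimension `2 ^ k` and `d = min wt (N(S) - ⟨S, iI⟩)`. -/
structure IsStabilizerCode (S : Subgroup (Op ι)ˣ) (k d : ℕ) : Prop where
  isStabilizerGroup : IsStabilizerGroup S
  finrank_eq : Module.finrank ℂ (codespace S) = 2 ^ k
  distance : IsLeast ((fun L : (Op ι)ˣ => weight (L : Op ι)) '' nontrivialLogicals S S) d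

/-- The elements of `S` with support in `B`. -/
def supportedOn (S : Subgroup (Op ι)ˣ) (B : Finset ι) : Set (Op ι)ˣ :=
  {U | U ∈ S ∧ supp (U : Op ι) ⊆ B}

/-! ### Correctable sets of qubits -/

/-- The label which is `z` on the qubits of `B` and `x` on all others. -/
def glue (B : Finset ι) (x : Label ι) (z : Label B) : Label ι :=
  fun j => if h : j ∈ B then z ⟨j, h⟩ else x j

/-- The channel that is completely depolarizing on `B`, that is
`ρ ↦ Tr_B ρ ⊗ I_B / 2 ^ |B|`. -/
def depolarize (B : Finset ι) (ρ : Op ι) : Op ι :=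
  fun x y => if ∀ j ∈ B, x j = y j then
    (∑ z : Label B, ρ (glue B x z) (glue B y z)) / 2 ^ B.card else 0

/-- `Φ` is a quantum channel (completely positive and trace preserving), in Kraus form. -/
def IsChannel (Φ : Op ι → Op ι) : Prop :=
  ∃ (m : ℕ) (R : Fin m → Op ι), ∑ a, (R a).conjTranspose * R a = 1 ∧
    ∀ ρ, Φ ρ = ∑ a, R a * ρ * (R a).conjTranspose

/-- `B` is correctable for the code `C`: some recovery channel undoes the completely
depolarizing channel on `B` on all code states `|ψ⟩⟨ψ|`. -/
def IsCorrectable (C : Submodule ℂ (State ι)) (B : Finset ι) : Prop :=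
  ∃ Φ : Op ι → Op ι, IsChannel Φ ∧ ∀ ψ ∈ C,
    Φ (depolarize B (Matrix.vecMulVec ψ (star ψ))) = Matrix.vecMulVec ψ (star ψ)

/-! ### Entanglement-assisted stabilizer codes -/

variable (ι) in
/-- Generators `Z̃_1, …, Z̃_{c+r}, X̃_1, …, X̃_c` of the (possibly nonabelian) group of an
entanglement-assisted stabilizer code with `c` ebits and `r` ancillas. They act on the sender's
qubits and satisfy the standard Pauli commutation relations. The index `Sum.inl i` stands for
the `i`-th symplectic pair, `Sum.inr j` for the `j`-th isotropic generator. -/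
structure EAGenerators (c r : ℕ) where
  Z : Fin c ⊕ Fin r → (Op ι)ˣ
  X : Fin c → (Op ι)ˣ
  Z_mem : ∀ i, Z i ∈ pauliGroup ι
  X_mem : ∀ i, X i ∈ pauliGroup ι
  Z_comm_Z : ∀ i j, Z i * Z j = Z j * Z i
  X_comm_X : ∀ i j, X i * X j = X j * X i
  X_comm_Z : ∀ i j, j ≠ Sum.inl i → X i * Z j = Z j * X i
  X_anticomm_Z : ∀ i, X i * Z (Sum.inl i) = -(Z (Sum.inl i) * X i)

namespace EAGenerators

variable {c r : ℕ} (G : EAGenerators ι c r)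

/-- The group `S` generated by all generators. -/
def group : Subgroup (Op ι)ˣ := Subgroup.closure (Set.range G.Z ∪ Set.range G.X)

/-- The isotropic subgroup `S_I`, generated by the unpaired generators. -/
def isotropic : Subgroup (Op ι)ˣ := Subgroup.closure (Set.range fun j => G.Z (Sum.inr j))

/-- The extended generators on the sender's qubits together with the receiver's `c` qubits:
`Z̃_i ⊗ Z_i` and `X̃_i ⊗ X_i` for the symplectic pairs, `Z̃_j ⊗ I` for the isotropic ones. -/
def extended : Set (Op (ι ⊕ Fin c)) :=
  (Set.range fun i => tensorPair (G.Z (Sum.inl i) : Op ι) (onQubit i pauliZ)) ∪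
  (Set.range fun i => tensorPair (G.X i : Op ι) (onQubit i pauliX)) ∪
  (Set.range fun j => tensorPair (G.Z (Sum.inr j) : Op ι) (1 : Op (Fin c)))

/-- The entanglement-assisted code: the space stabilized by the extended generators. -/
def codespace : Submodule ℂ (State (ι ⊕ Fin c)) := fixedSpace G.extended

/-- The generators define an `[[n, k, d; c]]` entanglement-assisted stabilizer code, `n` being
the number of the sender's qubits: these encode `k` logical qubits, `r` ancillas and the
sender's halves of `c` ebits, the code has dimension `2 ^ k` (so the extended generators are
independent and do not generate `-I`), and `d = min wt (N(S) - ⟨S_I, iI⟩)`. -/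
structure IsCode (k d : ℕ) : Prop where
  card_eq : k + r + c = Fintype.card ι
  finrank_eq : Module.finrank ℂ G.codespace = 2 ^ k
  distance : IsLeast
    ((fun L : (Op ι)ˣ => weight (L : Op ι)) '' nontrivialLogicals G.group G.isotropic) d

end EAGenerators

/-- There is an entanglement-assisted stabilizer code with parameters `[[n, k, d; c]]`. -/
def ExistsEACode (n k d c : ℕ) : Prop :=
  ∃ (r : ℕ) (G : EAGenerators (Fin n) c r), G.IsCode k d

end EAQ

end

/-! Up to phase, Pauli operators on `n` qubits are vectors of the symplectic space `𝔽₂^{2n}`: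
commutation is orthogonality, and a stabilizer group becomes an isotropic subspace `M`, of dimension
`n - k` because the trace of the averaging projector is the dimension of the code
(`finrank_codespace_mul_card`).

The sender keeps the qubits outside `B`, with `P` the restriction of `M` to them. The kernel of this
restriction is the part of `M` supported on `B`, so `dim P = n - k - s`. Correctability enters once,
through `IsCorrectable.mem_labels`: a vector of `Mᗮ` supported on `B` already lies in `M`. It has
two consequences. The radical of `P` consists of the vectors whose extension by zero lies in `M`
(`inf_orthogonal_map_restrictVec`), and the restriction of `M` to `B` has dimension `2b - s`
(`finrank_map_restrictVec_add_of_correctable`). Hence the radical has dimension `r = n - k - 2b +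
s`, and `dim P - r = 2(b - s)`: a symplectic basis of `P` has `b - s` hyperbolic pairs and `r`
isotropic vectors, with `k + r + (b - s) = n - b`. Attaching `Z_i`, `X_i` on the receiver's side
makes these generators commute, and independence gives a code of dimension `2^k` (`exists_isCode`).

A vector of `Pᗮ` outside `P`, extended by zero, lies in `Mᗮ` outside `M` with the same weight, so
the distance of `P` is at least `d`. It may be larger. Symplectic transvections along vectors
supported on two qubits preserve all dimensions and change weights by at most one, so they can lower
the distance to exactly `d` (`HasDistance.exists_of_le`). -/

noncomputable section

set_option linter.unusedSectionVars false

/-! ### The dictionary between Pauli operators and symplectic vectors over `𝔽₂`. -/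

namespace EAQ

open Matrix

variable {ι κ : Type} [Fintype ι] [DecidableEq ι] [Fintype κ] [DecidableEq κ]

/-! ### One-qubit Pauli matrices labelled by `𝔽₂²` -/

/-- The Hermitian Pauli matrix `X^a Z^b`, up to phase. -/
def pauliMat (p : ZMod 2 × ZMod 2) : Matrix (Fin 2) (Fin 2) ℂ :=
  if p.1 = 0 then (if p.2 = 0 then 1 else pauliZ) else (if p.2 = 0 then pauliX else pauliY)

lemma zmod_two_pair_cases (p : ZMod 2 × ZMod 2) :
    p = (0, 0) ∨ p = (1, 0) ∨ p = (0, 1) ∨ p = (1, 1) := by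
  revert p; decide

lemma pauliMat_zero : pauliMat (0, 0) = 1 := by simp [pauliMat]
lemma pauliMat_x : pauliMat (1, 0) = pauliX := by simp [pauliMat]
lemma pauliMat_z : pauliMat (0, 1) = pauliZ := by simp [pauliMat]
lemma pauliMat_y : pauliMat (1, 1) = pauliY := by simp [pauliMat]

/-- The sign `(-1)^a`. -/
def sgn (a : ZMod 2) : ℂ := (-1) ^ a.val

@[simp] lemma sgn_zero : sgn 0 = 1 := by simp [sgn]

@[simp] lemma sgn_one : sgn 1 = -1 := by simp [sgn, ZMod.val_one]

lemma zmod_two_cases (a : ZMod 2) : a = 0 ∨ a = 1 := by revert a; decide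

lemma sgn_add (a b : ZMod 2) : sgn (a + b) = sgn a * sgn b := by
  have h : (1 + 1 : ZMod 2) = 0 := by decide
  rcases zmod_two_cases a with rfl | rfl <;> rcases zmod_two_cases b with rfl | rfl <;>
    simp [h]

lemma sgn_sum {α : Type*} (s : Finset α) (f : α → ZMod 2) :
    sgn (∑ i ∈ s, f i) = ∏ i ∈ s, sgn (f i) := by
  classical
  induction s using Finset.induction_on with
  | empty => simp
  | insert a s ha ih => rw [Finset.sum_insert ha, Finset.prod_insert ha, sgn_add, ih]

/-- The symplectic form on `𝔽₂²`. -/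
def symp (p q : ZMod 2 × ZMod 2) : ZMod 2 := p.1 * q.2 + p.2 * q.1

lemma pauliMat_mul (p q : ZMod 2 × ZMod 2) :
    ∃ t : ℕ, pauliMat p * pauliMat q = Complex.I ^ t • pauliMat (p + q) := by
  have h : (1 + 1 : ZMod 2) = 0 := by decide
  rcases zmod_two_pair_cases p with rfl | rfl | rfl | rfl <;>
  rcases zmod_two_pair_cases q with rfl | rfl | rfl | rfl <;>
  simp only [Prod.mk_add_mk, h, add_zero, zero_add, pauliMat_zero, pauliMat_x, pauliMat_y,
    pauliMat_z, one_mul, mul_one]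
  -- Exponent 0 covers the identity and squares; two distinct nontrivial Paulis multiply to `i` or
  -- `-i = i³` times the third.
  all_goals first
    | (refine ⟨0, ?_⟩; ext i j; fin_cases i <;> fin_cases j <;>
        simp [pauliX, pauliY, pauliZ] <;> done)
    | (refine ⟨1, ?_⟩; ext i j; fin_cases i <;> fin_cases j <;>
        simp [pauliX, pauliY, pauliZ] <;> done)
    | (refine ⟨3, ?_⟩; ext i j; fin_cases i <;> fin_cases j <;>
        simp [pauliX, pauliY, pauliZ, Complex.I_pow_three])

lemma pauliMat_mul_self (p : ZMod 2 × ZMod 2) : pauliMat p * pauliMat p = 1 := by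
  rcases zmod_two_pair_cases p with rfl | rfl | rfl | rfl <;>
  simp only [pauliMat_zero, pauliMat_x, pauliMat_y, pauliMat_z] <;>
  ext i j <;> fin_cases i <;> fin_cases j <;> simp [pauliX, pauliY, pauliZ]

lemma pauliMat_conjTranspose (p : ZMod 2 × ZMod 2) : (pauliMat p)ᴴ = pauliMat p := by
  rcases zmod_two_pair_cases p with rfl | rfl | rfl | rfl <;>
  simp only [pauliMat_zero, pauliMat_x, pauliMat_y, pauliMat_z] <;>
  ext i j <;> fin_cases i <;> fin_cases j <;> simp [pauliX, pauliY, pauliZ]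

lemma pauliMat_swap (p q : ZMod 2 × ZMod 2) :
    pauliMat p * pauliMat q = sgn (symp p q) • (pauliMat q * pauliMat p) := by
  have h : (1 + 1 : ZMod 2) = 0 := by decide
  rcases zmod_two_pair_cases p with rfl | rfl | rfl | rfl <;>
  rcases zmod_two_pair_cases q with rfl | rfl | rfl | rfl <;>
  simp only [symp, mul_zero, mul_one, h, add_zero, zero_add, pauliMat_zero,
    pauliMat_x, pauliMat_y, pauliMat_z, one_mul, sgn_zero, sgn_one, one_smul] <;>
  ext i j <;> fin_cases i <;> fin_cases j <;> simp [pauliX, pauliY, pauliZ]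

lemma trace_pauliMat (p : ZMod 2 × ZMod 2) : (pauliMat p).trace = if p = 0 then 2 else 0 := by
  rcases zmod_two_pair_cases p with rfl | rfl | rfl | rfl <;>
  simp [pauliMat_zero, pauliMat_x, pauliMat_y, pauliMat_z, pauliX, pauliY, pauliZ,
    Matrix.trace_fin_two, Prod.ext_iff]

/-- The shift of the computational basis effected by a Pauli matrix. -/
def shift (p : ZMod 2 × ZMod 2) : Fin 2 := p.1

/-- Pauli matrices are monomial, with entries of modulus one. Conjugating a density matrix by a
Pauli operator is therefore a relabelling of the basis with phases. -/
lemma pauliMat_apply_of_ne (p : ZMod 2 × ZMod 2) {x y : Fin 2} (h : y ≠ x + shift p) :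
    pauliMat p x y = 0 := by
  rcases zmod_two_pair_cases p with rfl | rfl | rfl | rfl <;>
  fin_cases x <;> fin_cases y <;>
  simp [shift, pauliMat_zero, pauliMat_x, pauliMat_y, pauliMat_z, pauliX, pauliY, pauliZ] at h ⊢

lemma pauliMat_apply_mul_star (p : ZMod 2 × ZMod 2) (x : Fin 2) :
    pauliMat p x (x + shift p) * star (pauliMat p x (x + shift p)) = 1 := by
  rcases zmod_two_pair_cases p with rfl | rfl | rfl | rfl <;>
  fin_cases x <;>
  simp [shift, pauliMat_zero, pauliMat_x, pauliMat_y, pauliMat_z, pauliX, pauliY, pauliZ]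

lemma pauliMat_apply_ne_zero (p : ZMod 2 × ZMod 2) (x : Fin 2) :
    pauliMat p x (x + shift p) ≠ 0 := by
  intro h
  simpa [h] using pauliMat_apply_mul_star p x

lemma pauliMat_nontrivial {p : ZMod 2 × ZMod 2} (hp : p ≠ 0) :
    ∃ x y : Fin 2, pauliMat p x y ≠ if x = y then pauliMat p 0 0 else 0 := by
  rcases zmod_two_pair_cases p with rfl | rfl | rfl | rfl
  · exact absurd rfl hp
  · exact ⟨0, 1, by simp [pauliMat_x, pauliX]⟩
  · exact ⟨1, 1, by simp only [pauliMat_z, pauliZ]; norm_num⟩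
  · exact ⟨0, 1, by simp [pauliMat_y, pauliY]⟩

/-! ### Tensor products of one-qubit operators -/

lemma tensorOp_mul (A B : ι → Matrix (Fin 2) (Fin 2) ℂ) :
    tensorOp A * tensorOp B = tensorOp fun j => A j * B j := by
  ext x y
  simp only [Matrix.mul_apply, tensorOp, ← Finset.prod_mul_distrib]
  exact (Fintype.prod_sum fun j z => A j (x j) z * B j z (y j)).symm

lemma tensorOp_one : tensorOp (fun _ : ι => (1 : Matrix (Fin 2) (Fin 2) ℂ)) = 1 := by
  ext x y
  simp only [tensorOp, Matrix.one_apply]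
  rw [Finset.prod_ite_zero]
  simp [funext_iff]

lemma tensorOp_smul (c : ι → ℂ) (A : ι → Matrix (Fin 2) (Fin 2) ℂ) :
    tensorOp (fun j => c j • A j) = (∏ j, c j) • tensorOp A := by
  ext x y
  simp [tensorOp, Finset.prod_mul_distrib]

lemma trace_tensorOp (A : ι → Matrix (Fin 2) (Fin 2) ℂ) :
    (tensorOp A).trace = ∏ j, (A j).trace := by
  simp only [Matrix.trace, Matrix.diag, tensorOp]
  exact (Fintype.prod_sum fun j z => A j z z).symm

lemma tensorOp_conjTranspose (A : ι → Matrix (Fin 2) (Fin 2) ℂ) :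
    (tensorOp A)ᴴ = tensorOp fun j => (A j)ᴴ := by
  ext x y
  simp [tensorOp, Matrix.conjTranspose_apply]

lemma tensorPair_tensorOp (A : ι → Matrix (Fin 2) (Fin 2) ℂ)
    (B : κ → Matrix (Fin 2) (Fin 2) ℂ) :
    tensorPair (tensorOp A) (tensorOp B) = tensorOp (Sum.elim A B) := by
  ext x y
  simp [tensorPair, tensorOp]

/-! ### Pauli operators labelled by symplectic vectors -/

/-- The binary symplectic space labelling Pauli operators up to phase. -/
abbrev PVec (ι : Type) := ι → ZMod 2 × ZMod 2

/-- The Hermitian Pauli operator labelled by `v`. -/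
def pauliOp (v : PVec ι) : Op ι := tensorOp fun j => pauliMat (v j)

lemma pauliOp_zero : pauliOp (0 : PVec ι) = 1 := by
  rw [← tensorOp_one]
  simp only [pauliOp, Pi.zero_apply]
  congr 1

lemma pauliOp_mul (v w : PVec ι) :
    ∃ t : ℕ, pauliOp v * pauliOp w = Complex.I ^ t • pauliOp (v + w) := by
  choose t ht using fun j => pauliMat_mul (v j) (w j)
  refine ⟨∑ j, t j, ?_⟩
  simp only [pauliOp, tensorOp_mul, ht, tensorOp_smul, Finset.prod_pow_eq_pow_sum, Pi.add_apply]

lemma pauliOp_mul_self (v : PVec ι) : pauliOp v * pauliOp v = 1 := by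
  simp only [pauliOp, tensorOp_mul, pauliMat_mul_self, tensorOp_one]

lemma pauliOp_conjTranspose (v : PVec ι) : (pauliOp v)ᴴ = pauliOp v := by
  simp only [pauliOp, tensorOp_conjTranspose, pauliMat_conjTranspose]

/-- The symplectic form. -/
def sympForm (ι : Type) [Fintype ι] : LinearMap.BilinForm (ZMod 2) (PVec ι) :=
  LinearMap.mk₂ (ZMod 2) (fun v w => ∑ j, symp (v j) (w j))
    (by intros; simp only [← Finset.sum_add_distrib, symp, Pi.add_apply, Prod.fst_add,
          Prod.snd_add]; congr 1; funext; ring)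
    (by intros; simp only [Finset.mul_sum, symp, Pi.smul_apply, Prod.smul_fst, Prod.smul_snd,
          smul_eq_mul]; refine Finset.sum_congr rfl fun _ _ => ?_; ring)
    (by intros; simp only [← Finset.sum_add_distrib, symp, Pi.add_apply, Prod.fst_add,
          Prod.snd_add]; congr 1; funext; ring)
    (by intros; simp only [Finset.mul_sum, symp, Pi.smul_apply, Prod.smul_fst, Prod.smul_snd,
          smul_eq_mul]; refine Finset.sum_congr rfl fun _ _ => ?_; ring)

lemma sympForm_apply (v w : PVec ι) : sympForm ι v w = ∑ j, symp (v j) (w j) := rfl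

lemma pauliOp_swap (v w : PVec ι) :
    pauliOp v * pauliOp w = sgn (sympForm ι v w) • (pauliOp w * pauliOp v) := by
  have h : (fun j => pauliMat (v j) * pauliMat (w j)) =
      fun j => sgn (symp (v j) (w j)) • (pauliMat (w j) * pauliMat (v j)) :=
    funext fun j => pauliMat_swap _ _
  simp only [pauliOp, tensorOp_mul]
  rw [h, tensorOp_smul, sympForm_apply, sgn_sum]

lemma trace_pauliOp (v : PVec ι) :
    (pauliOp v).trace = if v = 0 then 2 ^ Fintype.card ι else 0 := by
  rw [pauliOp, trace_tensorOp]
  simp only [trace_pauliMat]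
  split_ifs with h
  · simp [h]
  · obtain ⟨j, hj⟩ := Function.ne_iff.mp h
    exact Finset.prod_eq_zero (Finset.mem_univ j) (if_neg hj)

lemma trace_pauliOp_zero : (pauliOp (0 : PVec ι)).trace = 2 ^ Fintype.card ι := by
  rw [trace_pauliOp, if_pos rfl]

lemma pauliOp_ne_zero (v : PVec ι) : pauliOp v ≠ 0 := by
  intro h
  have := pauliOp_mul_self v
  rw [h, mul_zero] at this
  exact zero_ne_one this

lemma pvec_add_self (v : PVec ι) : v + v = 0 := by
  funext j
  simp only [Pi.add_apply, Pi.zero_apply]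
  generalize v j = p
  revert p; decide

lemma pvec_add_eq_zero {v w : PVec ι} : v + w = 0 ↔ v = w := by
  constructor
  · intro h
    have := congrArg (· + w) h
    simpa [add_assoc, pvec_add_self] using this
  · rintro rfl
    exact pvec_add_self v

/-- Distinct Pauli operators are trace-orthogonal: multiplying by `pauliOp w` and taking traces
forces `b = 0` if `v ≠ w`. -/
lemma pauliOp_smul_injective {v w : PVec ι} {a b : ℂ} (ha : a ≠ 0)
    (h : a • pauliOp v = b • pauliOp w) : v = w := by
  obtain ⟨t, ht⟩ := pauliOp_mul v w
  have hc : a • (pauliOp v * pauliOp w) = b • (1 : Op ι) := by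
    rw [← smul_mul_assoc, h, smul_mul_assoc, pauliOp_mul_self]
  by_contra hne
  have hb : b = 0 := by
    have := congrArg Matrix.trace hc
    rw [ht, ← pauliOp_zero] at this
    simpa [Matrix.trace_smul, trace_pauliOp, pvec_add_eq_zero, hne] using this.symm
  rw [hb, zero_smul] at h
  exact (smul_ne_zero ha (pauliOp_ne_zero v)) h

/-! ### Units represented by symplectic vectors -/

/-- `U` is the Pauli operator labelled by `v`, up to a power of `i`. -/
def Rep (U : (Op ι)ˣ) (v : PVec ι) : Prop := ∃ t : ℕ, (U : Op ι) = Complex.I ^ t • pauliOp v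

/-- The Hermitian Pauli operator labelled by `v`, as a unit. -/
def pauliUnit (v : PVec ι) : (Op ι)ˣ :=
  ⟨pauliOp v, pauliOp v, pauliOp_mul_self v, pauliOp_mul_self v⟩

@[simp] lemma coe_pauliUnit (v : PVec ι) : (pauliUnit v : Op ι) = pauliOp v := rfl

lemma rep_pauliUnit (v : PVec ι) : Rep (pauliUnit v) v := ⟨0, by simp⟩

lemma pauliUnit_mul_self (v : PVec ι) : pauliUnit v * pauliUnit v = 1 :=
  Units.ext (pauliOp_mul_self v)

lemma rep_one : Rep (1 : (Op ι)ˣ) 0 := ⟨0, by simp [pauliOp_zero]⟩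

lemma Rep.mul {U U' : (Op ι)ˣ} {v w : PVec ι} (h : Rep U v) (h' : Rep U' w) :
    Rep (U * U') (v + w) := by
  obtain ⟨s, hs⟩ := h
  obtain ⟨s', hs'⟩ := h'
  obtain ⟨t, ht⟩ := pauliOp_mul v w
  refine ⟨s + s' + t, ?_⟩
  rw [Units.val_mul, hs, hs', smul_mul_smul_comm, ht, smul_smul, pow_add, pow_add]

lemma I_pow_four_mul (t : ℕ) : Complex.I ^ t * Complex.I ^ (3 * t) = 1 := by
  rw [← pow_add, show t + 3 * t = 4 * t by ring, pow_mul, Complex.I_pow_four, one_pow]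

lemma Rep.inv {U : (Op ι)ˣ} {v : PVec ι} (h : Rep U v) : Rep U⁻¹ v := by
  obtain ⟨t, ht⟩ := h
  refine ⟨3 * t, ?_⟩
  apply Units.inv_eq_of_mul_eq_one_right
  rw [ht, smul_mul_smul_comm, pauliOp_mul_self, I_pow_four_mul, one_smul]

lemma Rep.unique {U : (Op ι)ˣ} {v w : PVec ι} (h : Rep U v) (h' : Rep U w) : v = w := by
  obtain ⟨s, hs⟩ := h
  obtain ⟨t, ht⟩ := h'
  exact pauliOp_smul_injective (pow_ne_zero s Complex.I_ne_zero) (hs.symm.trans ht)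

lemma coe_phaseI : ((phaseI ι : (Op ι)ˣ) : Op ι) = Complex.I • 1 := by
  simp [phaseI, Algebra.algebraMap_eq_smul_one]

lemma rep_phaseI : Rep (phaseI ι) 0 := ⟨1, by rw [coe_phaseI, pauliOp_zero, pow_one]⟩

lemma coe_phaseI_pow (t : ℕ) : ((phaseI ι ^ t : (Op ι)ˣ) : Op ι) = Complex.I ^ t • 1 := by
  rw [Units.val_pow_eq_pow_val, coe_phaseI, smul_pow, one_pow]

lemma Rep.mem_zpowers {U : (Op ι)ˣ} (h : Rep U 0) :
    U ∈ Subgroup.zpowers (phaseI ι) := by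
  obtain ⟨t, ht⟩ := h
  refine ⟨t, Units.ext ?_⟩
  simp only [zpow_natCast]
  rw [coe_phaseI_pow, ht, pauliOp_zero]

lemma Rep.mul_eq {U U' : (Op ι)ˣ} {v w : PVec ι} (h : Rep U v) (h' : Rep U' w) :
    ((U * U' : (Op ι)ˣ) : Op ι) = sgn (sympForm ι v w) • ((U' * U : (Op ι)ˣ) : Op ι) := by
  obtain ⟨s, hs⟩ := h
  obtain ⟨t, ht⟩ := h'
  rw [Units.val_mul, Units.val_mul, hs, ht, smul_mul_smul_comm, smul_mul_smul_comm,
    pauliOp_swap, smul_smul, smul_smul]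
  congr 1
  ring

lemma Rep.commute_iff {U U' : (Op ι)ˣ} {v w : PVec ι} (h : Rep U v) (h' : Rep U' w) :
    U * U' = U' * U ↔ sympForm ι v w = 0 := by
  have key := h.mul_eq h'
  constructor
  · intro hc
    rcases zmod_two_cases (sympForm ι v w) with h0 | h1
    · exact h0
    · rw [h1, sgn_one, hc] at key
      have h2 : (2 : ℂ) • ((U' * U : (Op ι)ˣ) : Op ι) = 0 := by
        rw [two_smul]
        nth_rewrite 1 [key]
        simp
      have h3 := (smul_eq_zero.mp h2).resolve_left two_ne_zero
      exact absurd h3 (Units.ne_zero _)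
  · intro h0
    rw [h0, sgn_zero, one_smul] at key
    exact Units.ext key

lemma Rep.anticommute {U U' : (Op ι)ˣ} {v w : PVec ι} (h : Rep U v) (h' : Rep U' w)
    (h1 : sympForm ι v w = 1) : U * U' = -(U' * U) := by
  apply Units.ext
  rw [h.mul_eq h', h1]
  simp

/-! ### Supports -/

lemma Rep.actsTriviallyOn_iff {U : (Op ι)ˣ} {v : PVec ι} (h : Rep U v) (j : ι) :
    ActsTriviallyOn (U : Op ι) j ↔ v j = 0 := by
  obtain ⟨t, ht⟩ := h
  have entry : ∀ x y : Label ι, (U : Op ι) x y = Complex.I ^ t *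
      (pauliMat (v j) (x j) (y j) * ∏ l ∈ Finset.univ.erase j, pauliMat (v l) (x l) (y l)) := by
    intro x y
    rw [Finset.mul_prod_erase _ (fun l => pauliMat (v l) (x l) (y l)) (Finset.mem_univ j), ht]
    rfl
  have upd : ∀ x y : Label ι, (U : Op ι) (Function.update x j 0) (Function.update y j 0) =
      Complex.I ^ t * (pauliMat (v j) 0 0 *
        ∏ l ∈ Finset.univ.erase j, pauliMat (v l) (x l) (y l)) := by
    intro x y
    rw [entry, Function.update_self, Function.update_self]
    congr 2
    refine Finset.prod_congr rfl fun l hl => ?_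
    rw [Function.update_of_ne (Finset.ne_of_mem_erase hl),
      Function.update_of_ne (Finset.ne_of_mem_erase hl)]
  constructor
  · intro hE
    by_contra hj
    obtain ⟨a, b, hab⟩ := pauliMat_nontrivial hj
    apply hab
    -- Away from `j` the column label is the row label shifted by `v`, so the factors of the other
    -- qubits are nonzero and cancel.
    have hE' := hE (Function.update (fun _ => 0) j a)
      (Function.update (fun l => 0 + shift (v l)) j b)
    rw [upd, entry, Function.update_self, Function.update_self] at hE'
    have hr : ∏ l ∈ Finset.univ.erase j,
        pauliMat (v l) (Function.update (fun _ => (0 : Fin 2)) j a l)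
        (Function.update (fun l => 0 + shift (v l)) j b l) ≠ 0 := by
      refine Finset.prod_ne_zero_iff.mpr fun l hl => ?_
      rw [Function.update_of_ne (Finset.ne_of_mem_erase hl),
        Function.update_of_ne (Finset.ne_of_mem_erase hl)]
      exact pauliMat_apply_ne_zero _ _
    have hI : Complex.I ^ t ≠ 0 := pow_ne_zero t Complex.I_ne_zero
    split_ifs at hE' ⊢ with hs
    · exact mul_right_cancel₀ hr (mul_left_cancel₀ hI hE')
    · exact (mul_eq_zero.mp ((mul_eq_zero.mp hE').resolve_left hI)).resolve_right hr
  · intro hj x y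
    rw [upd, entry, hj, show (0 : ZMod 2 × ZMod 2) = (0, 0) from rfl, pauliMat_zero]
    by_cases hxy : x j = y j <;> simp [hxy, Matrix.one_apply]

lemma Rep.supp_eq {U : (Op ι)ˣ} {v : PVec ι} (h : Rep U v) :
    supp (U : Op ι) = {j | v j ≠ 0} := by
  ext j
  simp [supp, h.actsTriviallyOn_iff]

/-- The number of nonzero entries of a symplectic vector. -/
def pweight (v : PVec ι) : ℕ := (Finset.univ.filter fun j => v j ≠ 0).card

lemma Rep.weight_eq {U : (Op ι)ˣ} {v : PVec ι} (h : Rep U v) :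
    weight (U : Op ι) = pweight v := by
  rw [weight, h.supp_eq, pweight, ← Set.ncard_coe_finset]
  simp

/-! ### Pauli subgroups and subspaces of the symplectic space -/

lemma exists_rep_of_mem {U : (Op ι)ˣ} (h : U ∈ pauliGroup ι) : ∃ v, Rep U v := by
  induction h using Subgroup.closure_induction with
  | mem U hU =>
    rcases hU with hU | ⟨σ, hσ, hU⟩
    · rw [Set.mem_singleton_iff.mp hU]
      exact ⟨0, rep_phaseI⟩
    · have : ∀ j, ∃ p, σ j = pauliMat p := by
        intro j
        rcases hσ j with h | h | h | h
        · exact ⟨(0, 0), h.trans pauliMat_zero.symm⟩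
        · exact ⟨(1, 0), h.trans pauliMat_x.symm⟩
        · exact ⟨(1, 1), h.trans pauliMat_y.symm⟩
        · exact ⟨(0, 1), (Set.mem_singleton_iff.mp h).trans pauliMat_z.symm⟩
      choose v hv using this
      refine ⟨v, 0, ?_⟩
      rw [hU, pow_zero, one_smul, pauliOp, funext hv]
  | one => exact ⟨0, rep_one⟩
  | mul x y _ _ hx hy =>
    obtain ⟨v, hv⟩ := hx
    obtain ⟨w, hw⟩ := hy
    exact ⟨_, hv.mul hw⟩
  | inv x _ hx =>
    obtain ⟨v, hv⟩ := hx
    exact ⟨v, hv.inv⟩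

lemma pauliUnit_mem (v : PVec ι) : pauliUnit v ∈ pauliGroup ι := by
  refine Subgroup.subset_closure (Or.inr ⟨fun j => pauliMat (v j), fun j => ?_, rfl⟩)
  simp only [pauliMat]
  split_ifs <;> simp

lemma phaseI_mem : phaseI ι ∈ pauliGroup ι := Subgroup.subset_closure (Or.inl rfl)

lemma Rep.mem_pauliGroup {U : (Op ι)ˣ} {v : PVec ι} (h : Rep U v) : U ∈ pauliGroup ι := by
  have h1 : U * (pauliUnit v)⁻¹ ∈ pauliGroup ι := by
    have h0 := h.mul (rep_pauliUnit v).inv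
    rw [pvec_add_self] at h0
    exact (Subgroup.zpowers_le.mpr phaseI_mem) h0.mem_zpowers
  simpa using mul_mem h1 (pauliUnit_mem v)

/-- The Pauli operators with label in `M`. -/
def pauliLift (M : Submodule (ZMod 2) (PVec ι)) : Subgroup (Op ι)ˣ where
  carrier := {U | ∃ v ∈ M, Rep U v}
  one_mem' := ⟨0, M.zero_mem, rep_one⟩
  mul_mem' := by
    rintro a b ⟨v, hv, h⟩ ⟨w, hw, h'⟩
    exact ⟨v + w, M.add_mem hv hw, h.mul h'⟩
  inv_mem' := by
    rintro a ⟨v, hv, h⟩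
    exact ⟨v, hv, h.inv⟩

/-- The labels of the Pauli operators in `T`. -/
def labels (T : Subgroup (Op ι)ˣ) : Submodule (ZMod 2) (PVec ι) where
  carrier := {v | ∃ U ∈ T, Rep U v}
  zero_mem' := ⟨1, T.one_mem, rep_one⟩
  add_mem' := by
    rintro v w ⟨U, hU, h⟩ ⟨U', hU', h'⟩
    exact ⟨U * U', T.mul_mem hU hU', h.mul h'⟩
  smul_mem' := by
    rintro c v ⟨U, hU, h⟩
    rcases zmod_two_cases c with rfl | rfl
    · rw [zero_smul]
      exact ⟨1, T.one_mem, rep_one⟩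
    · rw [one_smul]
      exact ⟨U, hU, h⟩

lemma mem_labels {T : Subgroup (Op ι)ˣ} {v : PVec ι} : v ∈ labels T ↔ ∃ U ∈ T, Rep U v := Iff.rfl

lemma le_pauliLift_labels {T : Subgroup (Op ι)ˣ} (hT : T ≤ pauliGroup ι) :
    T ≤ pauliLift (labels T) := by
  intro U hU
  obtain ⟨v, hv⟩ := exists_rep_of_mem (hT hU)
  exact ⟨v, ⟨U, hU, hv⟩, hv⟩

lemma labels_closure_image (A : Set (PVec ι)) :
    labels (Subgroup.closure (pauliUnit '' A)) = Submodule.span (ZMod 2) A := by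
  apply le_antisymm
  · rintro v ⟨U, hU, hv⟩
    have hle : Subgroup.closure (pauliUnit '' A) ≤ pauliLift (Submodule.span (ZMod 2) A) := by
      rw [Subgroup.closure_le]
      rintro _ ⟨w, hw, rfl⟩
      exact ⟨w, Submodule.subset_span hw, rep_pauliUnit w⟩
    obtain ⟨w, hw, hUw⟩ := hle hU
    rwa [hv.unique hUw]
  · rw [Submodule.span_le]
    intro w hw
    exact ⟨_, Subgroup.subset_closure ⟨w, hw, rfl⟩, rep_pauliUnit w⟩

/-- Adjoining `iI` supplies every phase, so only the label of an operator decides membership. -/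
lemma mem_sup_zpowers_phaseI {T : Subgroup (Op ι)ˣ} (hT : T ≤ pauliGroup ι)
    {U : (Op ι)ˣ} {v : PVec ι} (h : Rep U v) :
    U ∈ T ⊔ Subgroup.zpowers (phaseI ι) ↔ v ∈ labels T := by
  constructor
  · intro hU
    have hle : T ⊔ Subgroup.zpowers (phaseI ι) ≤ pauliLift (labels T) :=
      sup_le (le_pauliLift_labels hT)
        (Subgroup.zpowers_le.mpr ⟨0, Submodule.zero_mem _, rep_phaseI⟩)
    obtain ⟨w, hw, hUw⟩ := hle hU
    rwa [h.unique hUw]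
  · rintro ⟨U', hU', h'⟩
    have h0 := h.mul h'.inv
    rw [pvec_add_self] at h0
    have h1 : U * U'⁻¹ ∈ T ⊔ Subgroup.zpowers (phaseI ι) :=
      (le_sup_right : Subgroup.zpowers (phaseI ι) ≤ _) h0.mem_zpowers
    simpa using mul_mem h1 ((le_sup_left : T ≤ T ⊔ Subgroup.zpowers (phaseI ι)) hU')

lemma sympForm_self (v : PVec ι) : sympForm ι v v = 0 := by
  rw [sympForm_apply]
  refine Finset.sum_eq_zero fun j _ => ?_
  generalize v j = p
  revert p; decide

lemma sympForm_comm (v w : PVec ι) : sympForm ι v w = sympForm ι w v := by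
  rw [sympForm_apply, sympForm_apply]
  refine Finset.sum_congr rfl fun j _ => ?_
  simp only [symp]
  ring

lemma sympForm_nondegenerate : (sympForm ι).Nondegenerate := by
  have key : ∀ v : PVec ι, (∀ w, sympForm ι v w = 0) → v = 0 := by
    intro v hv
    have hsum : ∀ (j : ι) (p : ZMod 2 × ZMod 2),
        sympForm ι v (Pi.single j p) = symp (v j) p := by
      intro j p
      rw [sympForm_apply, Finset.sum_eq_single j]
      · rw [Pi.single_eq_same]
      · intro l _ hl
        rw [Pi.single_eq_of_ne hl]
        simp [symp]
      · simp
    funext j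
    have h1 := hv (Pi.single j (0, 1))
    have h2 := hv (Pi.single j (1, 0))
    rw [hsum] at h1 h2
    simp only [symp, mul_one, mul_zero, add_zero, zero_add] at h1 h2
    exact Prod.ext h1 h2
  refine ⟨key, fun v hv => key v fun w => ?_⟩
  rw [sympForm_comm]
  exact hv w

lemma mem_orthogonal {M : Submodule (ZMod 2) (PVec ι)} {v : PVec ι} :
    v ∈ (sympForm ι).orthogonal M ↔ ∀ w ∈ M, sympForm ι v w = 0 := by
  rw [LinearMap.BilinForm.mem_orthogonal_iff]
  exact forall₂_congr fun w _ => by rw [sympForm_comm]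

lemma mem_pauliCentralizer {T : Subgroup (Op ι)ˣ} (hT : T ≤ pauliGroup ι)
    {U : (Op ι)ˣ} {v : PVec ι} (h : Rep U v) :
    U ∈ pauliCentralizer T ↔ v ∈ (sympForm ι).orthogonal (labels T) := by
  rw [pauliCentralizer, Subgroup.mem_inf, Subgroup.mem_centralizer_iff, mem_orthogonal]
  constructor
  · rintro ⟨-, hc⟩ w ⟨U', hU', h'⟩
    exact (h.commute_iff h').mp (hc U' hU').symm
  · intro hv
    refine ⟨h.mem_pauliGroup, fun U' hU' => ?_⟩
    obtain ⟨w, hw⟩ := exists_rep_of_mem (hT hU')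
    exact ((h.commute_iff hw).mpr (hv w ⟨U', hU', hw⟩)).symm

/-- Turns both notions of code distance into minimal weights of symplectic vectors; no operators are
needed after this. -/
lemma weight_image_nontrivialLogicals {T T' : Subgroup (Op ι)ˣ} (hT : T ≤ pauliGroup ι)
    (hT' : T' ≤ pauliGroup ι) :
    (fun L : (Op ι)ˣ => weight (L : Op ι)) '' nontrivialLogicals T T' =
      pweight '' {v | v ∈ (sympForm ι).orthogonal (labels T) ∧ v ∉ labels T'} := by
  ext d
  constructor
  · rintro ⟨L, ⟨hL, hL'⟩, rfl⟩
    obtain ⟨v, hv⟩ := exists_rep_of_mem hL.1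
    exact ⟨v, ⟨(mem_pauliCentralizer hT hv).mp hL,
      fun h => hL' ((mem_sup_zpowers_phaseI hT' hv).mpr h)⟩, hv.weight_eq.symm⟩
  · rintro ⟨v, ⟨hv, hv'⟩, rfl⟩
    have hr := rep_pauliUnit v
    exact ⟨pauliUnit v, ⟨(mem_pauliCentralizer hT hr).mpr hv,
      fun h => hv' ((mem_sup_zpowers_phaseI hT' hr).mp h)⟩, hr.weight_eq⟩

end EAQ

/-! ### Code dimensions by traces, and the meaning of correctability for logical operators. -/

namespace EAQ

open Matrix

variable {ι κ : Type} [Fintype ι] [DecidableEq ι] [Fintype κ] [DecidableEq κ]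

/-! ### Stabilizer groups and the dimension of their codes -/

lemma Rep.trace_eq_zero {U : (Op ι)ˣ} {v : PVec ι} (h : Rep U v) (hv : v ≠ 0) :
    (U : Op ι).trace = 0 := by
  obtain ⟨t, ht⟩ := h
  rw [ht, Matrix.trace_smul, trace_pauliOp, if_neg hv, smul_zero]

namespace IsStabilizerGroup

variable {S : Subgroup (Op ι)ˣ} (hS : IsStabilizerGroup S)

include hS

/-- The operator is a power of `i`; `i` and `-i` square to `-1`, which is not in `S`, so only the
identity remains. -/
lemma eq_one_of_rep_zero {U : (Op ι)ˣ} (hU : U ∈ S) (h : Rep U 0) : U = 1 := by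
  obtain ⟨t, ht⟩ := h
  rw [pauliOp_zero, Complex.I_pow_eq_pow_mod] at ht
  have h4 : t % 4 < 4 := Nat.mod_lt _ (by norm_num)
  generalize t % 4 = r at ht h4
  have hsq : ∀ a : ℂ, a * a = -1 → (U : Op ι) = a • 1 → False := by
    intro a ha hUa
    apply hS.neg_one_notMem
    have : U * U = -1 := by
      apply Units.ext
      rw [Units.val_mul, hUa, smul_mul_smul_comm, ha]
      simp
    rw [← this]
    exact mul_mem hU hU
  interval_cases r
  · exact Units.ext (by simpa using ht)
  · exact (hsq _ (by simp) ht).elim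
  · exfalso
    apply hS.neg_one_notMem
    have : U = -1 := Units.ext (by simpa using ht)
    rwa [← this]
  · exact (hsq _ (by simp [Complex.I_pow_three]) ht).elim

lemma eq_of_rep {U U' : (Op ι)ˣ} {v : PVec ι} (hU : U ∈ S) (hU' : U' ∈ S) (h : Rep U v)
    (h' : Rep U' v) : U = U' := by
  have h0 := h.mul h'.inv
  rw [pvec_add_self] at h0
  exact mul_inv_eq_one.mp (hS.eq_one_of_rep_zero (mul_mem hU (inv_mem hU')) h0)

lemma exists_bijective_labels :
    ∃ f : S → labels S, Function.Bijective f ∧ ∀ g : S, Rep (g : (Op ι)ˣ) (f g) := by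
  choose f hf using fun g : S => exists_rep_of_mem (hS.le_pauli g.2)
  refine ⟨fun g => ⟨f g, g, g.2, hf g⟩, ⟨fun g g' h => ?_, ?_⟩, hf⟩
  · refine Subtype.ext (hS.eq_of_rep g.2 g'.2 (hf g) ?_)
    rw [Subtype.mk.inj h]
    exact hf g'
  · rintro ⟨v, U, hU, hv⟩
    exact ⟨⟨U, hU⟩, Subtype.ext ((hf ⟨U, hU⟩).unique hv)⟩

lemma finite : Finite S := by
  obtain ⟨f, hf, -⟩ := hS.exists_bijective_labels
  exact Finite.of_injective f hf.1

lemma natCard_eq : Nat.card S = 2 ^ Module.finrank (ZMod 2) (labels S) := by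
  obtain ⟨f, hf, -⟩ := hS.exists_bijective_labels
  rw [Nat.card_eq_of_bijective f hf, Module.natCard_eq_pow_finrank (K := ZMod 2), Nat.card_zmod]

end IsStabilizerGroup

lemma mem_codespace {S : Subgroup (Op ι)ˣ} {ψ : State ι} :
    ψ ∈ codespace S ↔ ∀ U ∈ S, (U : Op ι) *ᵥ ψ = ψ := by
  constructor
  · exact fun h U hU => h _ ⟨U, hU, rfl⟩
  · rintro h _ ⟨U, hU, rfl⟩
    exact h U hU

/-- The average of a finite group of operators. -/
def groupAverage (S : Subgroup (Op ι)ˣ) [Fintype S] : Op ι :=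
  (Fintype.card S : ℂ)⁻¹ • ∑ g : S, ((g : (Op ι)ˣ) : Op ι)

lemma mul_groupAverage {S : Subgroup (Op ι)ˣ} [Fintype S] {U : (Op ι)ˣ} (hU : U ∈ S) :
    (U : Op ι) * groupAverage S = groupAverage S := by
  rw [groupAverage, mul_smul_comm, Finset.mul_sum]
  congr 1
  refine Fintype.sum_equiv (Equiv.mulLeft (⟨U, hU⟩ : S)) _ _ fun g => ?_
  simp

/-- Left translation permutes the summands, so the image is fixed by `S`; on fixed vectors every
summand acts as the identity. -/
lemma isProj_groupAverage (S : Subgroup (Op ι)ˣ) [Fintype S] :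
    LinearMap.IsProj (codespace S) (Matrix.toLin' (groupAverage S)) := by
  constructor
  · intro ψ
    rw [mem_codespace]
    intro U hU
    rw [Matrix.toLin'_apply, Matrix.mulVec_mulVec, mul_groupAverage hU]
  · intro ψ hψ
    have h0 : (Fintype.card S : ℂ) ≠ 0 := Nat.cast_ne_zero.mpr Fintype.card_ne_zero
    rw [Matrix.toLin'_apply, groupAverage, Matrix.smul_mulVec, Matrix.sum_mulVec,
      Finset.sum_congr rfl fun (g : S) _ => mem_codespace.mp hψ g g.2, Finset.sum_const,
      Finset.card_univ, ← Nat.cast_smul_eq_nsmul ℂ, smul_smul, inv_mul_cancel₀ h0, one_smul]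

lemma trace_groupAverage (S : Subgroup (Op ι)ˣ) [Fintype S] :
    (groupAverage S).trace = Module.finrank ℂ (codespace S) := by
  rw [← (isProj_groupAverage S).trace, Matrix.trace_toLin'_eq]

namespace IsStabilizerGroup

variable {S : Subgroup (Op ι)ˣ} (hS : IsStabilizerGroup S)

include hS

/-- A summand `U * g` has nonzero trace only if `U` and `g` have the same label, which `v ∉ labels
S` excludes. -/
lemma trace_mul_groupAverage [Fintype S] {U : (Op ι)ˣ} {v : PVec ι} (hU : Rep U v)
    (hv : v ∉ labels S) : ((U : Op ι) * groupAverage S).trace = 0 := by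
  rw [groupAverage, mul_smul_comm, Matrix.trace_smul, Finset.mul_sum, Matrix.trace_sum,
    Finset.sum_eq_zero, smul_zero]
  intro g _
  obtain ⟨w, hw⟩ := exists_rep_of_mem (hS.le_pauli g.2)
  rw [← Units.val_mul]
  refine (hU.mul hw).trace_eq_zero fun h => hv ?_
  rw [pvec_add_eq_zero.mp h]
  exact ⟨g, g.2, hw⟩

/-- Only the identity contributes to the trace of the projector, which is thus `2^n / |S|`. -/
lemma finrank_codespace_mul_card :
    Module.finrank ℂ (codespace S) * 2 ^ Module.finrank (ZMod 2) (labels S) =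
      2 ^ Fintype.card ι := by
  have := hS.finite
  have := Fintype.ofFinite S
  have h0 : (Fintype.card S : ℂ) ≠ 0 := Nat.cast_ne_zero.mpr Fintype.card_ne_zero
  have key := trace_groupAverage S
  rw [groupAverage, Matrix.trace_smul, Matrix.trace_sum, Fintype.sum_eq_single (1 : S)] at key
  · rw [Subgroup.coe_one, Units.val_one, ← pauliOp_zero, trace_pauliOp_zero, smul_eq_mul,
      inv_mul_eq_iff_eq_mul₀ h0, mul_comm] at key
    rw [← hS.natCard_eq, Nat.card_eq_fintype_card]
    exact_mod_cast key.symm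
  · intro g hg
    obtain ⟨w, hw⟩ := exists_rep_of_mem (hS.le_pauli g.2)
    refine hw.trace_eq_zero fun h => hg ?_
    rw [h] at hw
    exact Subtype.ext (hS.eq_one_of_rep_zero g.2 hw)

lemma labels_isotropic {v w : PVec ι} (hv : v ∈ labels S) (hw : w ∈ labels S) :
    sympForm ι v w = 0 := by
  obtain ⟨U, hU, h⟩ := hv
  obtain ⟨U', hU', h'⟩ := hw
  exact (h.commute_iff h').mp (hS.comm U hU U' hU')

/-- The elements of a stabilizer group supported on `B` correspond to their labels. -/
lemma ncard_supportedOn (B : Finset ι) :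
    (supportedOn S B).ncard = {v : PVec ι | v ∈ labels S ∧ ∀ j ∉ B, v j = 0}.ncard := by
  obtain ⟨f, hf, hrep⟩ := hS.exists_bijective_labels
  have hsupp : ∀ {U : (Op ι)ˣ} {v : PVec ι}, Rep U v →
      (supp (U : Op ι) ⊆ B ↔ ∀ j ∉ B, v j = 0) := by
    intro U v h
    rw [h.supp_eq]
    exact forall_congr' fun j => not_imp_comm
  refine Set.ncard_congr (fun U hU => (f ⟨U, hU.1⟩ : PVec ι)) ?_ ?_ ?_
  · intro U hU
    exact ⟨(f ⟨U, hU.1⟩).2, (hsupp (hrep ⟨U, hU.1⟩)).mp hU.2⟩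
  · intro U U' hU hU' h
    exact congrArg Subtype.val (hf.1 (Subtype.ext h))
  · rintro v ⟨hv, hv'⟩
    obtain ⟨g, hg⟩ := hf.2 ⟨v, hv⟩
    have hgv : (f g : PVec ι) = v := congrArg Subtype.val hg
    have hr := hrep g
    rw [hgv] at hr
    exact ⟨g, ⟨g.2, (hsupp hr).mpr hv'⟩, hgv⟩

end IsStabilizerGroup

/-! ### Correctable sets -/

/-- The shift of computational basis labels effected by a Pauli operator. -/
def shiftLabel (v : PVec ι) : Label ι := fun j => shift (v j)

/-- The phases of the nonzero entries of a Pauli operator. -/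
def pauliPhase (v : PVec ι) (x : Label ι) : ℂ := ∏ j, pauliMat (v j) (x j) (x j + shift (v j))

lemma pauliOp_apply (v : PVec ι) (x y : Label ι) :
    pauliOp v x y = if y = x + shiftLabel v then pauliPhase v x else 0 := by
  split_ifs with h
  · subst h
    rfl
  · obtain ⟨j, hj⟩ := Function.ne_iff.mp h
    exact Finset.prod_eq_zero (Finset.mem_univ j) (pauliMat_apply_of_ne (v j) hj)

lemma pauliPhase_mul_star (v : PVec ι) (x : Label ι) :
    pauliPhase v x * star (pauliPhase v x) = 1 := by
  rw [pauliPhase, star_prod, ← Finset.prod_mul_distrib]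
  exact Finset.prod_eq_one fun j _ => pauliMat_apply_mul_star _ _

lemma pauliOp_conj_apply (v : PVec ι) (ρ : Op ι) (x y : Label ι) :
    (pauliOp v * ρ * pauliOp v) x y =
      pauliPhase v x * ρ (x + shiftLabel v) (y + shiftLabel v) * star (pauliPhase v y) := by
  have hr : ∀ z, pauliOp v z y =
      if z = y + shiftLabel v then star (pauliPhase v y) else 0 := by
    intro z
    nth_rewrite 1 [← pauliOp_conjTranspose v]
    rw [Matrix.conjTranspose_apply, pauliOp_apply]
    split_ifs <;> simp
  rw [Matrix.mul_apply]
  simp only [hr, Matrix.mul_apply, pauliOp_apply, mul_ite, mul_zero, ite_mul, zero_mul,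
    Finset.sum_ite_eq', Finset.mem_univ, if_true]

/-- Conjugation only translates the labels on `B`, over which the partial trace sums; its phases
cancel. -/
lemma depolarize_pauliOp_conj {B : Finset ι} {v : PVec ι} (hv : ∀ j ∉ B, v j = 0) (ρ : Op ι) :
    depolarize B (pauliOp v * ρ * pauliOp v) = depolarize B ρ := by
  ext x y
  simp only [depolarize]
  split_ifs with hxy
  swap
  · rfl
  congr 1
  let a : Label B := fun j => shift (v j)
  have hglue : ∀ (x : Label ι) (z : Label B), glue B x z + shiftLabel v = glue B x (z + a) := by
    intro x z
    funext j
    by_cases hj : j ∈ B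
    · simp [glue, hj, shiftLabel, a]
    · simp [glue, hj, shiftLabel, hv j hj, show shift 0 = 0 from rfl]
  -- On `B` both glued labels equal `z`; off `B` the Pauli factor is the identity, whose diagonal
  -- entries are 1.
  have hphase : ∀ z, pauliPhase v (glue B x z) = pauliPhase v (glue B y z) := by
    intro z
    refine Finset.prod_congr rfl fun j _ => ?_
    by_cases hj : j ∈ B
    · simp [glue, hj]
    · have h0 : shift 0 = 0 := rfl
      have h1 : pauliMat 0 = 1 := pauliMat_zero
      simp [hv j hj, h0, h1]
  refine Fintype.sum_equiv (Equiv.addRight a) _ _ fun z => ?_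
  rw [pauliOp_conj_apply, hglue, hglue, hphase, mul_right_comm, pauliPhase_mul_star, one_mul]
  rfl

lemma exists_smul_of_vecMulVec_eq {α : Type*} {p q : α → ℂ}
    (h : vecMulVec p (star p) = vecMulVec q (star q)) : ∃ a : ℂ, p = a • q := by
  have hxy : ∀ x y, p x * star (p y) = q x * star (q y) := fun x y => congrFun (congrFun h x) y
  by_cases hp : p = 0
  · exact ⟨0, by simp [hp]⟩
  · obtain ⟨y, hy⟩ := Function.ne_iff.mp hp
    have hy' : star (p y) ≠ 0 := star_ne_zero.mpr hy
    refine ⟨star (q y) / star (p y), funext fun x => ?_⟩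
    rw [Pi.smul_apply, smul_eq_mul, div_mul_eq_mul_div, eq_div_iff hy', hxy, mul_comm]

lemma exists_smul_on_of_forall {M : Type*} [AddCommGroup M] [Module ℂ M] (C : Submodule ℂ M)
    (f : M →ₗ[ℂ] M) (h : ∀ x ∈ C, ∃ a : ℂ, f x = a • x) : ∃ a : ℂ, ∀ x ∈ C, f x = a • x := by
  have hC : ∀ x ∈ C, f x ∈ C := by
    intro x hx
    obtain ⟨a, ha⟩ := h x hx
    rw [ha]
    exact C.smul_mem a hx
  obtain ⟨a, ha⟩ := LinearMap.exists_eq_smul_id_of_forall_notLinearIndependent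
    (f := f.restrict hC) (by
      intro x hli
      obtain ⟨a, ha⟩ := h x x.2
      have hfx : (f.restrict hC) x = a • x := Subtype.ext ha
      have := LinearIndependent.pair_iff.mp hli a (-1) (by rw [hfx]; simp)
      simp at this)
  exact ⟨a, fun x hx => congrArg Subtype.val (LinearMap.congr_fun ha ⟨x, hx⟩)⟩

/-- Logical operators supported on a correctable set are trivial. -/
theorem IsCorrectable.mem_labels {S : Subgroup (Op ι)ˣ} (hS : IsStabilizerGroup S)
    (hC : Module.finrank ℂ (codespace S) ≠ 0) {B : Finset ι}
    (hB : IsCorrectable (codespace S) B) {v : PVec ι} (hv : ∀ j ∉ B, v j = 0)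
    (hvS : v ∈ (sympForm ι).orthogonal (labels S)) : v ∈ labels S := by
  obtain ⟨Φ, -, hΦ⟩ := hB
  have hmem : ∀ ψ ∈ codespace S, pauliOp v *ᵥ ψ ∈ codespace S := by
    intro ψ hψ
    rw [mem_codespace] at hψ ⊢
    intro U hU
    obtain ⟨w, hw⟩ := exists_rep_of_mem (hS.le_pauli hU)
    have hcomm := ((rep_pauliUnit v).commute_iff hw).mpr
      (EAQ.mem_orthogonal.mp hvS w ⟨U, hU, hw⟩)
    have hcomm' := congrArg Units.val hcomm
    rw [Units.val_mul, Units.val_mul, coe_pauliUnit] at hcomm'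
    rw [Matrix.mulVec_mulVec, ← hcomm', ← Matrix.mulVec_mulVec, hψ U hU]
  have hvec : ∀ ψ : State ι, vecMulVec (pauliOp v *ᵥ ψ) (star (pauliOp v *ᵥ ψ)) =
      pauliOp v * vecMulVec ψ (star ψ) * pauliOp v := by
    intro ψ
    rw [Matrix.star_mulVec, pauliOp_conjTranspose, Matrix.mul_vecMulVec, Matrix.vecMulVec_mul]
  -- Depolarizing `B` erases the action of `v`, so recovery returns the same state from `ψ` and from
  -- its image. Every code vector is then an eigenvector, and the operator is a scalar on the code.
  obtain ⟨a, ha⟩ := exists_smul_on_of_forall (codespace S) (Matrix.toLin' (pauliOp v)) (by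
    intro ψ hψ
    apply exists_smul_of_vecMulVec_eq
    rw [Matrix.toLin'_apply, ← hΦ _ (hmem ψ hψ), hvec, depolarize_pauliOp_conj hv, hΦ ψ hψ])
  have := hS.finite
  have := Fintype.ofFinite S
  have hmul : pauliOp v * groupAverage S = a • groupAverage S := by
    apply Matrix.toLin'.injective
    refine LinearMap.ext fun ψ => ?_
    have := ha _ ((isProj_groupAverage S).map_mem ψ)
    rw [Matrix.toLin'_mul, LinearMap.comp_apply, this, map_smul, LinearMap.smul_apply]
  have htr : (groupAverage S).trace ≠ 0 := by
    rw [trace_groupAverage]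
    exact_mod_cast hC
  have ha0 : a ≠ 0 := by
    rintro rfl
    rw [zero_smul] at hmul
    apply htr
    rw [← one_mul (groupAverage S), ← pauliOp_mul_self v, mul_assoc, hmul, mul_zero,
      Matrix.trace_zero]
  -- The operator times the code projector is a nonzero multiple of that projector, so it has
  -- nonzero trace; outside `labels S` the trace would vanish.
  by_contra hcon
  have h0 := hS.trace_mul_groupAverage (rep_pauliUnit v) hcon
  rw [coe_pauliUnit, hmul, Matrix.trace_smul] at h0
  exact (smul_ne_zero ha0 htr) h0

end EAQ

/-! ### Linear algebra of subspaces of the symplectic space: puncturing, distance, symplectic bases.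
-/

namespace EAQ

open Module

variable {ι κ μ : Type} [Fintype ι] [DecidableEq ι] [Fintype κ] [DecidableEq κ]
  [Fintype μ] [DecidableEq μ]

/-! ### Subspaces of the symplectic space -/

lemma finrank_pvec : finrank (ZMod 2) (PVec ι) = 2 * Fintype.card ι := by
  rw [Module.finrank_pi_fintype]
  simp [Module.finrank_prod, mul_comm]

lemma finrank_orthogonal_add (M : Submodule (ZMod 2) (PVec ι)) :
    finrank (ZMod 2) ((sympForm ι).orthogonal M) + finrank (ZMod 2) M = 2 * Fintype.card ι := by
  rw [LinearMap.BilinForm.finrank_orthogonal sympForm_nondegenerate, ← finrank_pvec]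
  exact Nat.sub_add_cancel M.finrank_le

lemma finrank_map_add_finrank_inf_ker {K V W : Type*} [Field K] [AddCommGroup V] [Module K V]
    [FiniteDimensional K V] [AddCommGroup W] [Module K W] (M : Submodule K V) (f : V →ₗ[K] W) :
    finrank K (M.map f) + finrank K (M ⊓ LinearMap.ker f : Submodule K V) = finrank K M := by
  have h := LinearMap.finrank_range_add_finrank_ker (f.domRestrict M)
  rw [LinearMap.range_domRestrict, LinearMap.ker_domRestrict] at h
  rw [← h, ← Submodule.map_comap_subtype, Submodule.finrank_map_subtype_eq]

/-- The form vanishes on `M`. -/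
def IsIsotropic (M : Submodule (ZMod 2) (PVec ι)) : Prop := M ≤ (sympForm ι).orthogonal M

lemma IsIsotropic.finrank_le {M : Submodule (ZMod 2) (PVec ι)} (hM : IsIsotropic M) :
    finrank (ZMod 2) M ≤ Fintype.card ι := by
  have h1 := finrank_orthogonal_add M
  have h2 := Submodule.finrank_mono hM
  omega

/-- `d` is the minimal weight of a vector of `Mᗮ` outside `M`. -/
def HasDistance (M : Submodule (ZMod 2) (PVec ι)) (d : ℕ) : Prop :=
  IsLeast (pweight '' {v | v ∈ (sympForm ι).orthogonal M ∧ v ∉ M}) d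

lemma exists_hasDistance {M : Submodule (ZMod 2) (PVec ι)}
    (h : ¬ (sympForm ι).orthogonal M ≤ M) : ∃ d, HasDistance M d := by
  obtain ⟨v, hv, hv'⟩ := SetLike.not_le_iff_exists.mp h
  have hne : (pweight '' {v | v ∈ (sympForm ι).orthogonal M ∧ v ∉ M}).Nonempty :=
    ⟨_, v, ⟨hv, hv'⟩, rfl⟩
  exact ⟨_, Nat.sInf_mem hne, fun _ h => Nat.sInf_le h⟩

lemma HasDistance.not_le {M : Submodule (ZMod 2) (PVec ι)} {d : ℕ} (h : HasDistance M d) :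
    ¬ (sympForm ι).orthogonal M ≤ M := by
  obtain ⟨⟨v, ⟨hv, hv'⟩, -⟩, -⟩ := h
  exact fun hle => hv' (hle hv)

lemma HasDistance.pos {M : Submodule (ZMod 2) (PVec ι)} {d : ℕ} (h : HasDistance M d) :
    0 < d := by
  obtain ⟨⟨v, ⟨-, hv⟩, rfl⟩, -⟩ := h
  rw [Nat.pos_iff_ne_zero]
  intro h0
  apply hv
  have : v = 0 := by
    funext j
    by_contra hj
    have : j ∈ (Finset.univ.filter fun j => v j ≠ 0) := by simpa using hj
    rw [Finset.card_eq_zero.mp h0] at this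
    simp at this
  rw [this]
  exact M.zero_mem

/-! ### Restriction to a subset of the qubits -/

/-- Restriction of symplectic vectors along an embedding of index sets. -/
def restrictVec (e : κ ↪ ι) : PVec ι →ₗ[ZMod 2] PVec κ :=
  LinearMap.funLeft (ZMod 2) (ZMod 2 × ZMod 2) e

@[simp] lemma restrictVec_apply (e : κ ↪ ι) (v : PVec ι) (k : κ) :
    restrictVec e v k = v (e k) := rfl

/-- Extension of symplectic vectors by zero. -/
def extendVec (e : κ ↪ ι) : PVec κ →ₗ[ZMod 2] PVec ι where
  toFun v := Function.extend e v 0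
  map_add' v w := by
    funext j
    by_cases h : ∃ k, e k = j
    · obtain ⟨k, rfl⟩ := h
      simp [e.injective.extend_apply]
    · simp [Function.extend_apply' _ _ _ h]
  map_smul' c v := by
    funext j
    by_cases h : ∃ k, e k = j
    · obtain ⟨k, rfl⟩ := h
      simp [e.injective.extend_apply]
    · simp [Function.extend_apply' _ _ _ h]

@[simp] lemma extendVec_apply (e : κ ↪ ι) (v : PVec κ) (k : κ) : extendVec e v (e k) = v k :=
  e.injective.extend_apply v 0 k

lemma extendVec_apply_of_notMem (e : κ ↪ ι) (v : PVec κ) {j : ι} (h : j ∉ Set.range e) :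
    extendVec e v j = 0 :=
  Function.extend_apply' _ _ _ h

@[simp] lemma restrictVec_extendVec (e : κ ↪ ι) (v : PVec κ) :
    restrictVec e (extendVec e v) = v := by
  funext k
  simp

lemma extendVec_injective (e : κ ↪ ι) : Function.Injective (extendVec e) :=
  Function.LeftInverse.injective (restrictVec_extendVec e)

lemma sympForm_extendVec (e : κ ↪ ι) (v : PVec κ) (x : PVec ι) :
    sympForm ι (extendVec e v) x = sympForm κ v (restrictVec e x) := by
  rw [sympForm_apply, sympForm_apply]
  symm
  apply Fintype.sum_of_injective e e.injective
  · intro j hj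
    simp [extendVec_apply_of_notMem e v hj, symp]
  · intro k
    simp

lemma pweight_extendVec (e : κ ↪ ι) (v : PVec κ) : pweight (extendVec e v) = pweight v := by
  rw [pweight, pweight, ← Finset.card_map e]
  congr 1
  ext j
  simp only [Finset.mem_filter, Finset.mem_univ, true_and, Finset.mem_map]
  constructor
  · intro h
    by_cases hj : j ∈ Set.range e
    · obtain ⟨k, rfl⟩ := hj
      exact ⟨k, by simpa using h, rfl⟩
    · exact absurd (extendVec_apply_of_notMem e v hj) h
  · rintro ⟨k, hk, rfl⟩
    simpa using hk

/-- Restriction and extension by zero are adjoint for the symplectic forms, so puncturing is dual to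
shortening. -/
lemma orthogonal_map_restrictVec (e : κ ↪ ι) (M : Submodule (ZMod 2) (PVec ι)) :
    (sympForm κ).orthogonal (M.map (restrictVec e)) =
      ((sympForm ι).orthogonal M).comap (extendVec e) := by
  ext v
  rw [mem_orthogonal, Submodule.mem_comap, mem_orthogonal]
  constructor
  · intro h w hw
    rw [sympForm_extendVec]
    exact h _ (Submodule.mem_map_of_mem hw)
  · rintro h _ ⟨w, hw, rfl⟩
    rw [← sympForm_extendVec]
    exact h w hw

lemma inf_ker_restrictVec {e : κ ↪ ι} {f : μ ↪ ι} (hef : IsCompl (Set.range e) (Set.range f))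
    (M : Submodule (ZMod 2) (PVec ι)) :
    M ⊓ LinearMap.ker (restrictVec e) = (M.comap (extendVec f)).map (extendVec f) := by
  ext x
  simp only [Submodule.mem_inf, LinearMap.mem_ker, Submodule.mem_map, Submodule.mem_comap]
  constructor
  · rintro ⟨hx, hx0⟩
    have : extendVec f (restrictVec f x) = x := by
      funext j
      by_cases hj : j ∈ Set.range f
      · obtain ⟨k, rfl⟩ := hj
        simp
      · rw [extendVec_apply_of_notMem f _ hj]
        rw [← Set.mem_compl_iff, hef.symm.compl_eq] at hj
        obtain ⟨k, rfl⟩ := hj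
        exact (congrFun hx0 k).symm
    exact ⟨restrictVec f x, by rwa [this], this⟩
  · rintro ⟨v, hv, rfl⟩
    refine ⟨hv, funext fun k => ?_⟩
    exact extendVec_apply_of_notMem f v
      (Set.disjoint_left.mp hef.disjoint (Set.mem_range_self k))

lemma finrank_map_restrictVec_add {e : κ ↪ ι} {f : μ ↪ ι}
    (hef : IsCompl (Set.range e) (Set.range f)) (M : Submodule (ZMod 2) (PVec ι)) :
    finrank (ZMod 2) (M.map (restrictVec e)) + finrank (ZMod 2) (M.comap (extendVec f)) =
      finrank (ZMod 2) M := by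
  rw [← finrank_map_add_finrank_inf_ker M (restrictVec e), inf_ker_restrictVec hef,
    (Submodule.equivMapOfInjective _ (extendVec_injective f) _).finrank_eq]

section Puncture

variable {e : κ ↪ ι} {f : μ ↪ ι} {M : Submodule (ZMod 2) (PVec ι)}

/-- If every vector of `Mᗮ` supported off `e` lies in `M`, then the radical of the restriction
of `M` along `e` is the subspace of vectors whose extension by zero lies in `M`. -/
lemma inf_orthogonal_map_restrictVec (hM : IsIsotropic M)
    (hcorr : ∀ x ∈ (sympForm ι).orthogonal M, (∀ k, x (e k) = 0) → x ∈ M) :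
    M.map (restrictVec e) ⊓ (sympForm κ).orthogonal (M.map (restrictVec e)) =
      M.comap (extendVec e) := by
  rw [orthogonal_map_restrictVec]
  apply le_antisymm
  · rintro v ⟨⟨x, hx, rfl⟩, hv⟩
    -- `x` and the zero extension of its restriction both lie in `Mᗮ` and agree on the kept qubits,
    -- so their sum vanishes there and `hcorr` applies.
    have hdiff : x + extendVec e (restrictVec e x) ∈ M := by
      refine hcorr _ (Submodule.add_mem _ (hM hx) hv) fun k => ?_
      rw [Pi.add_apply, extendVec_apply, restrictVec_apply]
      exact congrFun (pvec_add_self x) (e k)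
    have := M.add_mem hx hdiff
    rwa [← add_assoc, pvec_add_self, zero_add] at this
  · intro v hv
    exact ⟨⟨_, hv, restrictVec_extendVec e v⟩, hM hv⟩

/-- Shortening keeps isotropy, and an isotropic subspace has at most half the full dimension. This
gives `s ≤ b`. -/
lemma finrank_comap_extendVec_le (hM : IsIsotropic M) (f : μ ↪ ι) :
    finrank (ZMod 2) (M.comap (extendVec f)) ≤ Fintype.card μ := by
  apply IsIsotropic.finrank_le
  intro v hv
  rw [mem_orthogonal]
  intro w hw
  rw [← restrictVec_extendVec f w, ← sympForm_extendVec]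
  exact mem_orthogonal.mp (hM hv) _ hw

/-- On the correctable set `M` and `Mᗮ` have the same shortening, so the orthogonal of the punctured
space is the shortened one. -/
lemma finrank_map_restrictVec_add_of_correctable (hM : IsIsotropic M)
    (hef : IsCompl (Set.range e) (Set.range f))
    (hcorr : ∀ x ∈ (sympForm ι).orthogonal M, (∀ k, x (e k) = 0) → x ∈ M) :
    finrank (ZMod 2) (M.map (restrictVec f)) + finrank (ZMod 2) (M.comap (extendVec f)) =
      2 * Fintype.card μ := by
  have horth : (sympForm μ).orthogonal (M.map (restrictVec f)) = M.comap (extendVec f) := by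
    rw [orthogonal_map_restrictVec]
    apply le_antisymm
    · intro v hv
      refine hcorr _ hv fun k => ?_
      exact extendVec_apply_of_notMem f v
        (Set.disjoint_left.mp hef.disjoint (Set.mem_range_self k))
    · exact Submodule.comap_mono hM
  rw [← horth, add_comm, finrank_orthogonal_add]

/-- Puncturing does not decrease the distance. -/
lemma HasDistance.le_of_restrictVec {d d' : ℕ} (h : HasDistance M d)
    (h' : HasDistance (M.map (restrictVec e)) d') : d ≤ d' := by
  obtain ⟨⟨v, ⟨hv, hv'⟩, rfl⟩, -⟩ := h'
  rw [orthogonal_map_restrictVec] at hv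
  rw [← pweight_extendVec e]
  -- The zero extension of `v` cannot lie in `M`, since its restriction `v` would then lie in the
  -- punctured space.
  exact h.2 ⟨_, ⟨hv, fun hm => hv' ⟨_, hm, restrictVec_extendVec e v⟩⟩, rfl⟩

end Puncture

/-! ### Decreasing the distance by symplectic transvections -/

/-- The symplectic transvection along `w`. -/
def transvect (w : PVec ι) : PVec ι →ₗ[ZMod 2] PVec ι :=
  LinearMap.id + ((sympForm ι).flip w).smulRight w

lemma transvect_apply (w v : PVec ι) : transvect w v = v + sympForm ι v w • w := rfl

lemma transvect_involutive (w : PVec ι) : Function.Involutive (transvect w) := by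
  intro v
  rw [transvect_apply, transvect_apply, map_add, map_smul, LinearMap.add_apply,
    LinearMap.smul_apply, sympForm_self, smul_zero, add_zero, add_assoc, pvec_add_self, add_zero]

/-- Self-adjointness, combined with involutivity, makes the transvection an isometry. -/
lemma sympForm_transvect (w u v : PVec ι) :
    sympForm ι (transvect w u) v = sympForm ι u (transvect w v) := by
  simp only [transvect_apply, map_add, map_smul, LinearMap.add_apply, LinearMap.smul_apply,
    smul_eq_mul]
  rw [sympForm_comm w v, mul_comm]

lemma orthogonal_comap_transvect (w : PVec ι) (M : Submodule (ZMod 2) (PVec ι)) :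
    (sympForm ι).orthogonal (M.comap (transvect w)) =
      ((sympForm ι).orthogonal M).comap (transvect w) := by
  ext v
  rw [mem_orthogonal, Submodule.mem_comap, mem_orthogonal]
  constructor
  · intro h u hu
    rw [sympForm_transvect]
    apply h
    rwa [Submodule.mem_comap, transvect_involutive w u]
  · intro h u hu
    rw [← transvect_involutive w u, ← sympForm_transvect]
    exact h _ hu

lemma finrank_comap_transvect (w : PVec ι) (M : Submodule (ZMod 2) (PVec ι)) :
    finrank (ZMod 2) (M.comap (transvect w)) = finrank (ZMod 2) M := by
  let T := LinearEquiv.ofInvolutive (transvect w) (transvect_involutive w)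
  exact (congrArg (fun N : Submodule (ZMod 2) (PVec ι) => finrank (ZMod 2) N)
    (Submodule.comap_equiv_eq_map_symm T M)).trans (LinearEquiv.finrank_map_eq T.symm M)

/-- A transvection along a vector supported on two qubits increases weights by at most one. -/
lemma pweight_transvect_le (i j : ι) {w : PVec ι} (hw : ∀ l, l ≠ i → l ≠ j → w l = 0)
    (v : PVec ι) : pweight (transvect w v) ≤ pweight v + 1 := by
  rcases zmod_two_cases (sympForm ι v w) with h | h
  · rw [transvect_apply, h, zero_smul, add_zero]
    exact Nat.le_succ _
  rw [transvect_apply, h, one_smul]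
  -- If the form is 1, `v` is nonzero at one of the two qubits; adding `w` can then enlarge the
  -- support only at the other.
  have key : ∀ a b : ι, v a ≠ 0 → (∀ l, l ≠ a → l ≠ b → w l = 0) →
      pweight (v + w) ≤ pweight v + 1 := by
    intro a b ha hab
    refine le_trans (Finset.card_le_card (t := insert b (Finset.univ.filter fun j => v j ≠ 0))
      fun l hl => ?_) (Finset.card_insert_le _ _)
    rw [Finset.mem_insert, Finset.mem_filter]
    by_cases hlb : l = b
    · exact Or.inl hlb
    by_cases hla : l = a
    · exact Or.inr ⟨Finset.mem_univ _, hla ▸ ha⟩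
    · refine Or.inr ⟨Finset.mem_univ _, ?_⟩
      simpa [hab l hla hlb] using hl
  by_cases hi : v i = 0
  · by_cases hj : v j = 0
    · exfalso
      have h0 : sympForm ι v w = 0 := by
        rw [sympForm_apply]
        refine Finset.sum_eq_zero fun l _ => ?_
        by_cases hli : l = i
        · simp [hli, hi, symp]
        by_cases hlj : l = j
        · simp [hlj, hj, symp]
        · simp [hw l hli hlj, symp]
      rw [h0] at h
      exact zero_ne_one h
    · exact key j i hj fun l h1 h2 => hw l h2 h1
  · exact key i j hi hw

lemma exists_symp_eq_one {p : ZMod 2 × ZMod 2} (hp : p ≠ 0) : ∃ q, symp p q = 1 := by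
  revert p; decide

lemma symp_self (p : ZMod 2 × ZMod 2) : symp p p = 0 := by revert p; decide

/-- A vector of weight at least two becomes lighter under some transvection along a vector
supported on two qubits. -/
lemma exists_transvect_lt {v : PVec ι} (hv : 2 ≤ pweight v) :
    ∃ (i j : ι) (w : PVec ι), (∀ l, l ≠ i → l ≠ j → w l = 0) ∧
      pweight (transvect w v) < pweight v := by
  obtain ⟨i, hi, j, hj, hij⟩ := Finset.one_lt_card.mp hv
  obtain ⟨q, hq⟩ := exists_symp_eq_one (Finset.mem_filter.mp hj).2
  -- Copying `v` at `i` makes the sum vanish there and contributes 0 to the form; `q` at `j`,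
  -- already in the support of `v`, makes the form 1.
  let w : PVec ι := Function.update (Function.update 0 j q) i (v i)
  have hwi : w i = v i := by simp [w]
  have hwj : w j = q := by simp [w, hij.symm]
  have hw0 : ∀ l, l ≠ i → l ≠ j → w l = 0 := fun l h1 h2 => by simp [w, h1, h2]
  refine ⟨i, j, w, hw0, ?_⟩
  have hform : sympForm ι v w = 1 := by
    rw [sympForm_apply, Fintype.sum_eq_add i j hij, hwi, hwj, symp_self, hq, zero_add]
    rintro l ⟨h1, h2⟩
    simp [hw0 l h1 h2, symp]
  rw [transvect_apply, hform, one_smul]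
  have hsub : (Finset.univ.filter fun l => (v + w) l ≠ 0) ⊆
      (Finset.univ.filter fun l => v l ≠ 0).erase i := by
    intro l hl
    have hli : l ≠ i := by
      rintro rfl
      apply (Finset.mem_filter.mp hl).2
      rw [Pi.add_apply, hwi]
      exact congrFun (pvec_add_self v) l
    rw [Finset.mem_erase]
    refine ⟨hli, ?_⟩
    by_cases hlj : l = j
    · rwa [hlj]
    · simpa [hw0 l hli hlj] using hl
  exact lt_of_le_of_lt (Finset.card_le_card hsub) (Finset.card_erase_lt_of_mem hi)

/-- A transvection that lightens a vector of minimal weight lowers every other weight by at most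
one, so the minimum drops by exactly one. -/
lemma HasDistance.exists_pred {M : Submodule (ZMod 2) (PVec ι)} {d : ℕ}
    (h : HasDistance M (d + 1)) (hd : 1 ≤ d) :
    ∃ M' : Submodule (ZMod 2) (PVec ι), finrank (ZMod 2) M' = finrank (ZMod 2) M ∧
      finrank (ZMod 2) (M' ⊓ (sympForm ι).orthogonal M' : Submodule (ZMod 2) (PVec ι)) =
        finrank (ZMod 2) (M ⊓ (sympForm ι).orthogonal M : Submodule (ZMod 2) (PVec ι)) ∧
      HasDistance M' d := by
  obtain ⟨⟨v, ⟨hv, hvM⟩, hvd⟩, hmin⟩ := h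
  obtain ⟨i, j, w, hw, hlt⟩ := exists_transvect_lt (v := v) (by omega)
  have hle : ∀ u, pweight u ≤ pweight (transvect w u) + 1 := by
    intro u
    have := pweight_transvect_le i j hw (transvect w u)
    rwa [transvect_involutive w u] at this
  refine ⟨M.comap (transvect w), finrank_comap_transvect w M, ?_, ?_, ?_⟩
  · rw [orthogonal_comap_transvect, ← Submodule.comap_inf, finrank_comap_transvect]
  · refine ⟨transvect w v, ⟨?_, ?_⟩, ?_⟩
    · rwa [orthogonal_comap_transvect, Submodule.mem_comap, transvect_involutive w v]
    · rwa [Submodule.mem_comap, transvect_involutive w v]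
    · have := hle v
      omega
  · rintro _ ⟨u, ⟨hu, huM⟩, rfl⟩
    rw [orthogonal_comap_transvect] at hu
    have h1 := hmin ⟨transvect w u, ⟨hu, huM⟩, rfl⟩
    have h2 := pweight_transvect_le i j hw u
    omega

/-- The distance can be lowered to any positive value without changing the dimensions. -/
lemma HasDistance.exists_of_le {M : Submodule (ZMod 2) (PVec ι)} {d d' : ℕ}
    (h : HasDistance M d') (hd : 1 ≤ d) (hdd' : d ≤ d') :
    ∃ M' : Submodule (ZMod 2) (PVec ι), finrank (ZMod 2) M' = finrank (ZMod 2) M ∧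
      finrank (ZMod 2) (M' ⊓ (sympForm ι).orthogonal M' : Submodule (ZMod 2) (PVec ι)) =
        finrank (ZMod 2) (M ⊓ (sympForm ι).orthogonal M : Submodule (ZMod 2) (PVec ι)) ∧
      HasDistance M' d := by
  induction d', hdd' using Nat.le_induction generalizing M with
  | base => exact ⟨M, rfl, rfl, h⟩
  | succ m hm ih =>
    obtain ⟨M₁, h1, h2, h3⟩ := h.exists_pred (hd.trans hm)
    obtain ⟨M₂, h4, h5, h6⟩ := ih h3
    exact ⟨M₂, h4.trans h1, h5.trans h2, h6⟩

/-! ### Symplectic bases -/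

/-- Symplectic Gram–Schmidt: split off a hyperbolic pair and continue in its orthogonal complement
inside `M`, which has the same radical and dimension smaller by two. At `c = 0` the radical is all
of `M`. -/
lemma exists_symplectic_basis (c r : ℕ) (M : Submodule (ZMod 2) (PVec ι))
    (hM : finrank (ZMod 2) M = 2 * c + r)
    (hR : finrank (ZMod 2) (M ⊓ (sympForm ι).orthogonal M : Submodule (ZMod 2) (PVec ι)) = r) :
    ∃ (Z : Fin c ⊕ Fin r → PVec ι) (X : Fin c → PVec ι),
      (∀ i j, sympForm ι (Z i) (Z j) = 0) ∧ (∀ i j, sympForm ι (X i) (X j) = 0) ∧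
      (∀ i j, j ≠ Sum.inl i → sympForm ι (X i) (Z j) = 0) ∧
      (∀ i, sympForm ι (X i) (Z (Sum.inl i)) = 1) ∧
      Submodule.span (ZMod 2) (Set.range (Sum.elim Z X)) = M ∧
      Submodule.span (ZMod 2) (Set.range fun j => Z (Sum.inr j)) =
        M ⊓ (sympForm ι).orthogonal M := by
  induction c generalizing M with
  | zero =>
    have hinf : M ⊓ (sympForm ι).orthogonal M = M :=
      Submodule.eq_of_le_of_finrank_eq inf_le_left (by rw [hR, hM]; omega)
    rw [hinf]
    have hle : M ≤ (sympForm ι).orthogonal M := inf_eq_left.mp hinf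
    let b := Module.finBasisOfFinrankEq (ZMod 2) M (by omega : finrank (ZMod 2) M = r)
    have hspan : Submodule.span (ZMod 2) (Set.range fun j => (b j : PVec ι)) = M := by
      have := congrArg (Submodule.map M.subtype) b.span_eq
      rw [Submodule.map_span, Submodule.map_top, Submodule.range_subtype, ← Set.range_comp]
        at this
      exact this
    refine ⟨Sum.elim Fin.elim0 fun j => (b j : PVec ι), Fin.elim0, ?_, fun i => i.elim0,
      fun i => i.elim0, fun i => i.elim0, ?_, hspan⟩
    · rintro (i | i) (j | j)
      · exact i.elim0
      · exact i.elim0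
      · exact j.elim0
      · exact mem_orthogonal.mp (hle (b i).2) _ (b j).2
    · rw [Set.Sum.elim_range, Set.Sum.elim_range,
        Set.range_eq_empty (Fin.elim0 : Fin 0 → PVec ι), Set.empty_union, Set.union_empty]
      exact hspan
  | succ c ih =>
    obtain ⟨x, hx, z, hz, hxz⟩ : ∃ x ∈ M, ∃ z ∈ M, sympForm ι x z = 1 := by
      by_contra! hcon
      have hle : M ≤ (sympForm ι).orthogonal M := fun x hx =>
        mem_orthogonal.mpr fun z hz => (zmod_two_cases _).resolve_right (hcon x hx z hz)
      rw [inf_eq_left.mpr hle] at hR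
      omega
    have hzx : sympForm ι z x = 1 := by rw [sympForm_comm, hxz]
    let φ : PVec ι →ₗ[ZMod 2] ZMod 2 × ZMod 2 := (sympForm ι x).prod (sympForm ι z)
    let M' := M ⊓ LinearMap.ker φ
    have hmem : ∀ {y}, y ∈ M' ↔ y ∈ M ∧ sympForm ι x y = 0 ∧ sympForm ι z y = 0 := by
      intro y
      rw [Submodule.mem_inf, LinearMap.mem_ker]
      exact and_congr_right fun _ => Prod.mk_eq_zero
    -- Projection along the hyperbolic plane of `x` and `z`; signs are irrelevant in characteristic
    -- two.
    have hdecomp : ∀ y ∈ M, y + sympForm ι z y • x + sympForm ι x y • z ∈ M' := by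
      intro y hy
      refine hmem.mpr ⟨M.add_mem (M.add_mem hy (M.smul_mem _ hx)) (M.smul_mem _ hz), ?_, ?_⟩
      · simp only [map_add, map_smul, sympForm_self, hxz, smul_eq_mul, mul_zero, mul_one,
          add_zero]
        exact CharTwo.add_self_eq_zero _
      · simp only [map_add, map_smul, sympForm_self, hzx, smul_eq_mul, mul_zero, mul_one,
          add_zero]
        exact CharTwo.add_self_eq_zero _
    have hrec : ∀ y, (y + sympForm ι z y • x + sympForm ι x y • z) +
        (sympForm ι z y • x + sympForm ι x y • z) = y := by
      intro y
      rw [add_assoc y, add_assoc, pvec_add_self, add_zero]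
    have hrad : M' ⊓ (sympForm ι).orthogonal M' = M ⊓ (sympForm ι).orthogonal M := by
      apply le_antisymm
      · rintro u ⟨hu, hu'⟩
        obtain ⟨huM, hux, huz⟩ := hmem.mp hu
        refine ⟨huM, mem_orthogonal.mpr fun y hy => ?_⟩
        rw [← hrec y, map_add, mem_orthogonal.mp hu' _ (hdecomp y hy), map_add, map_smul,
          map_smul, sympForm_comm u x, sympForm_comm u z, hux, huz, smul_zero, smul_zero,
          add_zero, add_zero]
      · rintro u ⟨hu, hu'⟩
        have hu'' := mem_orthogonal.mp hu'
        refine ⟨hmem.mpr ⟨hu, ?_, ?_⟩, mem_orthogonal.mpr fun y hy => hu'' y (hmem.mp hy).1⟩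
        · rw [sympForm_comm, hu'' x hx]
        · rw [sympForm_comm, hu'' z hz]
    have hdim : finrank (ZMod 2) M' = 2 * c + r := by
      have h := finrank_map_add_finrank_inf_ker M φ
      -- The pair itself maps onto a basis of `𝔽₂²`, so imposing both orthogonality conditions costs
      -- exactly two dimensions.
      have htop : M.map φ = ⊤ := by
        rw [eq_top_iff]
        rintro ⟨a, b⟩ -
        refine ⟨a • z + b • x, M.add_mem (M.smul_mem _ hz) (M.smul_mem _ hx), ?_⟩
        simp [φ, hxz, hzx, sympForm_self]
      rw [htop, finrank_top, Module.finrank_prod, Module.finrank_self, hM] at h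
      change 1 + 1 + finrank (ZMod 2) M' = _ at h
      omega
    obtain ⟨Z, X, hZZ, hXX, hXZ, hXZ1, hspan, hspan'⟩ := ih M' hdim (by rw [hrad, hR])
    have hZ : ∀ i, Z i ∈ M' := fun i => hspan ▸ Submodule.subset_span ⟨Sum.inl i, rfl⟩
    have hX : ∀ i, X i ∈ M' := fun i => hspan ▸ Submodule.subset_span ⟨Sum.inr i, rfl⟩
    have hxM : ∀ {y}, y ∈ M' → sympForm ι x y = 0 := fun h => (hmem.mp h).2.1
    have hzM : ∀ {y}, y ∈ M' → sympForm ι z y = 0 := fun h => (hmem.mp h).2.2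
    have hMx : ∀ {y}, y ∈ M' → sympForm ι y x = 0 := fun h => by rw [sympForm_comm, hxM h]
    have hMz : ∀ {y}, y ∈ M' → sympForm ι y z = 0 := fun h => by rw [sympForm_comm, hzM h]
    let Z₁ : Fin (c + 1) ⊕ Fin r → PVec ι :=
      Sum.elim (Fin.cons z fun i => Z (Sum.inl i)) fun j => Z (Sum.inr j)
    let X₁ : Fin (c + 1) → PVec ι := Fin.cons x X
    have hZ₁0 : Z₁ (Sum.inl 0) = z := rfl
    have hZ₁s : ∀ i : Fin c, Z₁ (Sum.inl i.succ) = Z (Sum.inl i) := fun _ => rfl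
    have hZ₁r : ∀ j, Z₁ (Sum.inr j) = Z (Sum.inr j) := fun _ => rfl
    have hX₁0 : X₁ 0 = x := rfl
    have hX₁s : ∀ i : Fin c, X₁ i.succ = X i := fun _ => rfl
    have hZ₁ : ∀ i, Z₁ i = z ∨ ∃ i', Z₁ i = Z i' := by
      rintro (i | j)
      · induction i using Fin.cases with
        | zero => exact Or.inl rfl
        | succ i => exact Or.inr ⟨_, rfl⟩
      · exact Or.inr ⟨_, rfl⟩
    refine ⟨Z₁, X₁, ?_, ?_, ?_, ?_, ?_, ?_⟩
    · intro i j
      rcases hZ₁ i with h | ⟨i', h⟩ <;> rcases hZ₁ j with h' | ⟨j', h'⟩ <;> rw [h, h']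
      · exact sympForm_self z
      · exact hzM (hZ _)
      · exact hMz (hZ _)
      · exact hZZ _ _
    · intro i j
      induction i using Fin.cases <;> induction j using Fin.cases <;>
        simp only [hX₁0, hX₁s]
      · exact sympForm_self x
      · exact hxM (hX _)
      · exact hMx (hX _)
      · exact hXX _ _
    · rintro i (j | j) hij
      · induction i using Fin.cases <;> induction j using Fin.cases <;>
          simp only [hX₁0, hX₁s, hZ₁0, hZ₁s]
        · exact absurd rfl hij
        · exact hxM (hZ _)
        · exact hMz (hX _)
        · refine hXZ _ _ fun h => hij ?_
          rw [Sum.inl.inj h]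
      · induction i using Fin.cases <;> simp only [hX₁0, hX₁s, hZ₁r]
        · exact hxM (hZ _)
        · exact hXZ _ _ (by simp)
    · intro i
      induction i using Fin.cases
      · exact hxz
      · exact hXZ1 _
    · apply le_antisymm
      · rw [Submodule.span_le]
        rintro _ ⟨i | i, rfl⟩
        · rcases hZ₁ i with h | ⟨i', h⟩
          · exact (congrArg (· ∈ M) h).mpr hz
          · exact (congrArg (· ∈ M) h).mpr (hmem.mp (hZ i')).1
        · induction i using Fin.cases with
          | zero => exact hx
          | succ i => exact (hmem.mp (hX i)).1
      · have hle : M' ≤ Submodule.span (ZMod 2) (Set.range (Sum.elim Z₁ X₁)) := by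
          rw [← hspan]
          apply Submodule.span_mono
          rintro _ ⟨(i | i) | i, rfl⟩
          · exact ⟨Sum.inl (Sum.inl i.succ), rfl⟩
          · exact ⟨Sum.inl (Sum.inr i), rfl⟩
          · exact ⟨Sum.inr i.succ, rfl⟩
        intro y hy
        rw [← hrec y]
        refine Submodule.add_mem _ (hle (hdecomp y hy)) (Submodule.add_mem _
          (Submodule.smul_mem _ _ (Submodule.subset_span ⟨Sum.inr 0, rfl⟩))
          (Submodule.smul_mem _ _ (Submodule.subset_span ⟨Sum.inl (Sum.inl 0), rfl⟩)))
    · rw [← hrad]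
      exact hspan'

end EAQ

/-! ### Back to operators: building the entanglement-assisted code and comparing parameters. -/

namespace EAQ

open Module Matrix

variable {ι κ : Type} [Fintype ι] [DecidableEq ι] [Fintype κ] [DecidableEq κ]

/-! ### Stabilizer groups generated by independent commuting Pauli operators -/

lemma rep_neg_one : Rep (-1 : (Op ι)ˣ) 0 := ⟨2, by simp [pauliOp_zero]⟩

lemma isStabilizerGroup_bot : IsStabilizerGroup (⊥ : Subgroup (Op ι)ˣ) where
  le_pauli := bot_le
  comm := by
    intro g hg h hh
    rw [Subgroup.mem_bot.mp hg, Subgroup.mem_bot.mp hh]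
  neg_one_notMem := by
    rw [Subgroup.mem_bot]
    intro h
    have h1 := congrArg (fun U : (Op ι)ˣ => (U : Op ι).trace) h
    have h2 : (1 : Op ι).trace = 2 ^ Fintype.card ι := by rw [← pauliOp_zero, trace_pauliOp_zero]
    simp only [Units.val_neg, Units.val_one, Matrix.trace_neg, h2] at h1
    have h3 : (2 : ℂ) ^ Fintype.card ι ≠ 0 := pow_ne_zero _ two_ne_zero
    exact h3 (self_eq_neg.mp h1.symm)

/-- The enlarged group is the union of `T` and its coset by the new involution, so `-1` in it would
put `w` among the labels of `T`. -/
lemma IsStabilizerGroup.closure_insert {T : Subgroup (Op ι)ˣ} (hT : IsStabilizerGroup T)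
    {w : PVec ι} (hw : w ∈ (sympForm ι).orthogonal (labels T)) (hwT : w ∉ labels T) :
    IsStabilizerGroup (Subgroup.closure (insert (pauliUnit w) (T : Set (Op ι)ˣ))) := by
  set h := pauliUnit w
  have hh : h * h = 1 := pauliUnit_mul_self w
  have hinv : h⁻¹ = h := inv_eq_of_mul_eq_one_right hh
  have hcomm : ∀ t ∈ T, Commute h t := by
    intro t ht
    obtain ⟨v, hv⟩ := exists_rep_of_mem (hT.le_pauli ht)
    exact ((rep_pauliUnit w).commute_iff hv).mpr (mem_orthogonal.mp hw v ⟨t, ht, hv⟩)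
  have key : ∀ g ∈ Subgroup.closure (insert h (T : Set (Op ι)ˣ)),
      g ∈ T ∨ ∃ t ∈ T, g = h * t := by
    intro g hg
    induction hg using Subgroup.closure_induction with
    | mem x hx =>
      rcases hx with rfl | hx
      · exact Or.inr ⟨1, T.one_mem, (mul_one _).symm⟩
      · exact Or.inl hx
    | one => exact Or.inl T.one_mem
    | mul x y _ _ hx hy =>
      rcases hx with hx | ⟨t, ht, rfl⟩ <;> rcases hy with hy | ⟨t', ht', rfl⟩
      · exact Or.inl (T.mul_mem hx hy)
      · exact Or.inr ⟨x * t', T.mul_mem hx ht', (hcomm x hx).symm.left_comm t'⟩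
      · exact Or.inr ⟨t * y, T.mul_mem ht hy, mul_assoc _ _ _⟩
      · refine Or.inl ?_
        rw [mul_assoc, (hcomm t ht).symm.left_comm, ← mul_assoc, hh, one_mul]
        exact T.mul_mem ht ht'
    | inv x _ hx =>
      rcases hx with hx | ⟨t, ht, rfl⟩
      · exact Or.inl (T.inv_mem hx)
      · refine Or.inr ⟨t⁻¹, T.inv_mem ht, ?_⟩
        rw [_root_.mul_inv_rev, hinv]
        exact (hcomm _ (T.inv_mem ht)).symm
  have hTT : ∀ t ∈ T, ∀ t' ∈ T, Commute t t' := hT.comm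
  refine ⟨?_, ?_, ?_⟩
  · rw [Subgroup.closure_le]
    rintro g (rfl | hg)
    · exact pauliUnit_mem w
    · exact hT.le_pauli hg
  · intro x hx y hy
    change Commute x y
    rcases key x hx with hx | ⟨t, ht, rfl⟩ <;> rcases key y hy with hy | ⟨t', ht', rfl⟩
    · exact hTT x hx y hy
    · exact (hcomm x hx).symm.mul_right (hTT x hx t' ht')
    · exact (hcomm y hy).mul_left (hTT t ht y hy)
    · exact ((Commute.refl h).mul_right (hcomm t' ht')).mul_left
        ((hcomm t ht).symm.mul_right (hTT t ht t' ht'))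
  · intro hmem
    rcases key _ hmem with hmem | ⟨t, ht, heq⟩
    · exact hT.neg_one_notMem hmem
    · apply hwT
      have ht' : t = h * -1 := by rw [heq, ← mul_assoc, hh, one_mul]
      refine ⟨t, ht, ?_⟩
      rw [ht', ← add_zero w]
      exact (rep_pauliUnit w).mul rep_neg_one

lemma isStabilizerGroup_closure_image {α : Type*} {u : α → PVec ι}
    (hu : LinearIndependent (ZMod 2) u) (hiso : ∀ a b, sympForm ι (u a) (u b) = 0)
    (F : Finset α) : IsStabilizerGroup (Subgroup.closure (pauliUnit '' (u '' F))) := by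
  classical
  induction F using Finset.induction_on with
  | empty =>
    rw [Finset.coe_empty, Set.image_empty, Set.image_empty, Subgroup.closure_empty]
    exact isStabilizerGroup_bot
  | insert a F ha ih =>
    rw [Finset.coe_insert, Set.image_insert_eq, Set.image_insert_eq]
    have := ih.closure_insert (w := u a) ?_ ?_
    · rwa [← Set.union_singleton, Subgroup.closure_union, Subgroup.closure_eq,
        ← Subgroup.closure_union, Set.union_singleton] at this
    · rw [labels_closure_image, mem_orthogonal]
      intro w hw
      have hle : Submodule.span (ZMod 2) (u '' F) ≤ LinearMap.ker (sympForm ι (u a)) := by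
        rw [Submodule.span_le]
        rintro _ ⟨b, -, rfl⟩
        exact hiso a b
      exact hle hw
    · rw [labels_closure_image]
      exact hu.notMem_span_image (by simpa using ha)

lemma codespace_closure (A : Set (Op ι)ˣ) :
    codespace (Subgroup.closure A) = fixedSpace ((fun U : (Op ι)ˣ => (U : Op ι)) '' A) := by
  apply le_antisymm
  · rintro ψ hψ _ ⟨U, hU, rfl⟩
    exact hψ _ ⟨U, Subgroup.subset_closure hU, rfl⟩
  · intro ψ hψ
    rw [mem_codespace]
    intro U hU
    induction hU using Subgroup.closure_induction with
    | mem U hU => exact hψ _ ⟨U, hU, rfl⟩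
    | one => exact Matrix.one_mulVec ψ
    | mul U U' _ _ h h' => rw [Units.val_mul, ← Matrix.mulVec_mulVec, h', h]
    | inv U _ h =>
      nth_rewrite 1 [← h]
      rw [Matrix.mulVec_mulVec, Units.inv_mul, Matrix.one_mulVec]

lemma finrank_fixedSpace {α : Type*} [Fintype α] {u : α → PVec ι}
    (hu : LinearIndependent (ZMod 2) u) (hiso : ∀ a b, sympForm ι (u a) (u b) = 0) :
    finrank ℂ (fixedSpace (Set.range fun a => pauliOp (u a))) * 2 ^ Fintype.card α =
      2 ^ Fintype.card ι := by
  have hst := isStabilizerGroup_closure_image hu hiso Finset.univ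
  have h := hst.finrank_codespace_mul_card
  rw [labels_closure_image, codespace_closure, Finset.coe_univ, Set.image_univ,
    finrank_span_eq_card hu, ← Set.range_comp, ← Set.range_comp] at h
  exact h

/-! ### Entanglement-assisted codes from symplectic bases -/

lemma onQubit_pauliMat (j : ι) (p : ZMod 2 × ZMod 2) :
    onQubit j (pauliMat p) = pauliOp (Pi.single j p) := by
  rw [onQubit, pauliOp]
  congr 1
  funext l
  by_cases hl : l = j
  · subst hl
    simp
  · rw [Function.update_of_ne hl, Pi.single_eq_of_ne hl]
    exact pauliMat_zero.symm

lemma tensorPair_pauliOp (v : PVec ι) (w : PVec κ) :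
    tensorPair (pauliOp v) (pauliOp w) = pauliOp (Sum.elim v w) := by
  rw [pauliOp, pauliOp, tensorPair_tensorOp, pauliOp]
  congr 1
  funext j
  rcases j with j | j <;> rfl

lemma sympForm_sumElim (v v' : PVec ι) (w w' : PVec κ) :
    sympForm (ι ⊕ κ) (Sum.elim v w) (Sum.elim v' w') = sympForm ι v v' + sympForm κ w w' := by
  simp [sympForm_apply, Fintype.sum_sum_type]

lemma sympForm_single (i j : ι) (p q : ZMod 2 × ZMod 2) :
    sympForm ι (Pi.single i p) (Pi.single j q) = if i = j then symp p q else 0 := by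
  rw [sympForm_apply, Finset.sum_eq_single i]
  · split_ifs with h
    · subst h
      simp
    · rw [Pi.single_eq_of_ne h]
      simp [symp]
  · intro l _ hl
    rw [Pi.single_eq_of_ne hl]
    simp [symp]
  · simp

/-- The entanglement-assisted generators labelled by a symplectic family. -/
def EAGenerators.ofVec {c r : ℕ} (Z : Fin c ⊕ Fin r → PVec ι) (X : Fin c → PVec ι)
    (hZZ : ∀ i j, sympForm ι (Z i) (Z j) = 0) (hXX : ∀ i j, sympForm ι (X i) (X j) = 0)
    (hXZ : ∀ i j, j ≠ Sum.inl i → sympForm ι (X i) (Z j) = 0)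
    (hXZ1 : ∀ i, sympForm ι (X i) (Z (Sum.inl i)) = 1) : EAGenerators ι c r where
  Z i := pauliUnit (Z i)
  X i := pauliUnit (X i)
  Z_mem _ := pauliUnit_mem _
  X_mem _ := pauliUnit_mem _
  Z_comm_Z i j := ((rep_pauliUnit _).commute_iff (rep_pauliUnit _)).mpr (hZZ i j)
  X_comm_X i j := ((rep_pauliUnit _).commute_iff (rep_pauliUnit _)).mpr (hXX i j)
  X_comm_Z i j h := ((rep_pauliUnit _).commute_iff (rep_pauliUnit _)).mpr (hXZ i j h)
  X_anticomm_Z i := (rep_pauliUnit _).anticommute (rep_pauliUnit _) (hXZ1 i)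

/-- The receiver's parts of the extended generators. -/
def receiverVec (c r : ℕ) : (Fin c ⊕ Fin r) ⊕ Fin c → PVec (Fin c) :=
  Sum.elim (Sum.elim (fun i => Pi.single i (0, 1)) 0) fun i => Pi.single i (1, 0)

/-- A subspace `M` with radical of dimension `r` and codimension `2c` over it yields an
entanglement-assisted code with `c` ebits and `r` ancillas. -/
theorem exists_isCode {c r k d : ℕ} {M : Submodule (ZMod 2) (PVec ι)}
    (hcard : k + r + c = Fintype.card ι) (hM : finrank (ZMod 2) M = 2 * c + r)
    (hR : finrank (ZMod 2) (M ⊓ (sympForm ι).orthogonal M : Submodule (ZMod 2) (PVec ι)) = r)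
    (hd : HasDistance M d) : ∃ G : EAGenerators ι c r, G.IsCode k d := by
  obtain ⟨Z, X, hZZ, hXX, hXZ, hXZ1, hspan, hspan'⟩ := exists_symplectic_basis c r M hM hR
  let G := EAGenerators.ofVec Z X hZZ hXX hXZ hXZ1
  -- The `2c + r` generators span a space of dimension `2c + r`.
  have hli : LinearIndependent (ZMod 2) (Sum.elim Z X) := by
    rw [linearIndependent_iff_card_eq_finrank_span, Set.finrank, hspan, hM]
    simp only [Fintype.card_sum, Fintype.card_fin]
    ring
  let u : (Fin c ⊕ Fin r) ⊕ Fin c → PVec (ι ⊕ Fin c) :=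
    fun a => Sum.elim (Sum.elim Z X a) (receiverVec c r a)
  have hu : LinearIndependent (ZMod 2) u := by
    apply LinearIndependent.of_comp (restrictVec (Function.Embedding.inl : ι ↪ ι ⊕ Fin c))
    exact hli
  -- For a symplectic pair the sender's form is 1 and the receiver's `X`, `Z` contribute another 1;
  -- the two cancel.
  have hXZ' : ∀ (i : Fin c) (j : Fin c ⊕ Fin r), sympForm _ (u (Sum.inr i)) (u (Sum.inl j)) = 0 := by
    intro i j
    simp only [u, sympForm_sumElim, Sum.elim_inl, Sum.elim_inr, receiverVec]
    rcases j with j | j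
    · by_cases hij : i = j
      · subst hij
        rw [hXZ1, Sum.elim_inl, sympForm_single, if_pos rfl]
        decide
      · rw [hXZ _ _ (fun h => hij (Sum.inl.inj h).symm), Sum.elim_inl, sympForm_single,
          if_neg hij, add_zero]
    · rw [hXZ _ _ (by simp)]
      simp
  have hiso : ∀ a b, sympForm _ (u a) (u b) = 0 := by
    rintro (i | i) (j | j)
    · simp only [u, sympForm_sumElim, Sum.elim_inl, hZZ, receiverVec]
      rcases i with i | i <;> rcases j with j | j <;>
        simp [sympForm_single, symp]
    · rw [sympForm_comm]
      exact hXZ' j i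
    · exact hXZ' i j
    · simp [u, sympForm_sumElim, hXX, receiverVec, sympForm_single, symp]
  have hext : G.extended = Set.range fun a => pauliOp (u a) := by
    have hZinl : ∀ i, tensorPair (G.Z (Sum.inl i) : Op ι) (onQubit i pauliZ) =
        pauliOp (u (Sum.inl (Sum.inl i))) := by
      intro i
      rw [← pauliMat_z, onQubit_pauliMat]
      exact tensorPair_pauliOp _ _
    have hX : ∀ i, tensorPair (G.X i : Op ι) (onQubit i pauliX) = pauliOp (u (Sum.inr i)) := by
      intro i
      rw [← pauliMat_x, onQubit_pauliMat]
      exact tensorPair_pauliOp _ _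
    have hZinr : ∀ j, tensorPair (G.Z (Sum.inr j) : Op ι) (1 : Op (Fin c)) =
        pauliOp (u (Sum.inl (Sum.inr j))) := by
      intro j
      rw [← pauliOp_zero]
      exact tensorPair_pauliOp _ _
    simp only [EAGenerators.extended, hZinl, hX, hZinr]
    ext E
    simp only [Set.mem_union, Set.mem_range, Sum.exists]
    tauto
  have hgroup : labels G.group = M := by
    rw [← hspan, ← labels_closure_image, Set.Sum.elim_range, Set.image_union, ← Set.range_comp,
      ← Set.range_comp]
    rfl
  have hisotropic : labels G.isotropic = M ⊓ (sympForm ι).orthogonal M := by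
    rw [← hspan', ← labels_closure_image, ← Set.range_comp]
    rfl
  have hle : G.group ≤ pauliGroup ι := by
    rw [EAGenerators.group, Subgroup.closure_le]
    rintro _ (⟨i, rfl⟩ | ⟨i, rfl⟩)
    · exact G.Z_mem i
    · exact G.X_mem i
  have hle' : G.isotropic ≤ pauliGroup ι := by
    rw [EAGenerators.isotropic, Subgroup.closure_le]
    rintro _ ⟨i, rfl⟩
    exact G.Z_mem _
  refine ⟨G, hcard, ?_, ?_⟩
  · have h := finrank_fixedSpace hu hiso
    rw [← hext] at h
    simp only [Fintype.card_sum, Fintype.card_fin] at h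
    -- There are `2c + r` independent generators on `k + r + 2c` qubits, which leaves dimension
    -- `2^k`.
    rw [show Fintype.card ι + c = k + (c + r + c) by omega, pow_add 2 k] at h
    exact Nat.eq_of_mul_eq_mul_right (Nat.two_pow_pos _) h
  · rw [weight_image_nontrivialLogicals hle hle', hgroup, hisotropic]
    have hset : {v | v ∈ (sympForm ι).orthogonal M ∧ v ∉ M ⊓ (sympForm ι).orthogonal M} =
        {v | v ∈ (sympForm ι).orthogonal M ∧ v ∉ M} := by
      ext v
      simp only [Set.mem_ofPred_eq, Submodule.mem_inf]
      tauto
    rw [hset]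
    exact hd

/-- Deleting a correctable set `B` of qubits from a stabilizer code yields an
entanglement-assisted code. -/
theorem IsStabilizerCode.existsEACode {n k d b s : ℕ} {S : Subgroup (Op (Fin n))ˣ}
    (hS : IsStabilizerCode S k d) {B : Finset (Fin n)} (hB : IsCorrectable (codespace S) B)
    (hb : B.card = b) (hs : (supportedOn S B).ncard = 2 ^ s) :
    s ≤ b ∧ ExistsEACode (n - b) k d (b - s) := by
  have hst := hS.isStabilizerGroup
  have hM : IsIsotropic (labels S) := fun v hv =>
    mem_orthogonal.mpr fun w hw => hst.labels_isotropic hv hw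
  have hbn : b ≤ n := by simpa [hb] using Finset.card_le_univ B
  let e : Fin (n - b) ↪ Fin n :=
    (Bᶜ.orderEmbOfFin (by rw [Finset.card_compl, hb, Fintype.card_fin])).toEmbedding
  let f : Fin b ↪ Fin n := (B.orderEmbOfFin hb).toEmbedding
  have he : Set.range e = (B : Set (Fin n))ᶜ := by
    rw [← Finset.coe_compl]
    exact Finset.range_orderEmbOfFin _ _
  have hf : Set.range f = B := Finset.range_orderEmbOfFin _ _
  have hef : IsCompl (Set.range e) (Set.range f) := by
    rw [he, hf]
    exact isCompl_compl.symm
  have hoff : ∀ x : PVec (Fin n), (∀ i, x (e i) = 0) ↔ ∀ j ∉ B, x j = 0 := by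
    intro x
    rw [← Set.forall_mem_range (f := e) (p := fun j => x j = 0), he]
    rfl
  have hcorr : ∀ x ∈ (sympForm (Fin n)).orthogonal (labels S),
      (∀ i, x (e i) = 0) → x ∈ labels S := fun x hx hx0 =>
    IsCorrectable.mem_labels hst (by rw [hS.finrank_eq]; positivity) hB ((hoff x).mp hx0) hx
  have hk : k + finrank (ZMod 2) (labels S) = n := by
    have h := hst.finrank_codespace_mul_card
    rw [hS.finrank_eq, ← pow_add, Fintype.card_fin] at h
    exact Nat.pow_right_injective le_rfl h
  have hsdim : finrank (ZMod 2) ((labels S).comap (extendVec f)) = s := by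
    rw [hst.ncard_supportedOn] at hs
    have hset : {v : PVec (Fin n) | v ∈ labels S ∧ ∀ j ∉ B, v j = 0} =
        (labels S ⊓ LinearMap.ker (restrictVec e) : Submodule (ZMod 2) (PVec (Fin n))) := by
      ext v
      rw [Set.mem_ofPred_eq, ← hoff, SetLike.mem_coe, Submodule.mem_inf, LinearMap.mem_ker,
        funext_iff]
      rfl
    rw [hset, inf_ker_restrictVec hef] at hs
    change Nat.card _ = _ at hs
    rw [SetLike.coe_sort_coe, Module.natCard_eq_pow_finrank (K := ZMod 2), Nat.card_zmod,
      ← (Submodule.equivMapOfInjective _ (extendVec_injective f) _).finrank_eq] at hs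
    exact Nat.pow_right_injective le_rfl hs
  have hdist : HasDistance (labels S) d := by
    have h := hS.distance
    rwa [weight_image_nontrivialLogicals hst.le_pauli hst.le_pauli] at h
  have hsb : s ≤ b := by
    have h := finrank_comap_extendVec_le hM f
    rwa [hsdim, Fintype.card_fin] at h
  have h1 := finrank_map_restrictVec_add hef (labels S)
  have h2 := finrank_map_restrictVec_add_of_correctable hM hef hcorr
  have h3 := finrank_map_restrictVec_add hef.symm (labels S)
  rw [hsdim] at h1 h2
  rw [Fintype.card_fin] at h2
  have hrad := inf_orthogonal_map_restrictVec hM hcorr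
  -- With `k = 0` the space `M` would be its own orthogonal, leaving no logical operator to attain
  -- the distance.
  have hkpos : 0 < k := by
    rw [Nat.pos_iff_ne_zero]
    rintro rfl
    have h := finrank_orthogonal_add (labels S)
    rw [Fintype.card_fin] at h
    exact hdist.not_le (Submodule.eq_of_le_of_finrank_le hM (by omega)).ge
  -- Otherwise the radical would be the whole orthogonal of the punctured space, and the dimension
  -- counts would force `k = 0`.
  have hne : ¬ (sympForm (Fin (n - b))).orthogonal ((labels S).map (restrictVec e)) ≤
      (labels S).map (restrictVec e) := by
    intro hle
    have h := finrank_orthogonal_add ((labels S).map (restrictVec e))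
    rw [inf_eq_right.mpr hle] at hrad
    rw [hrad, Fintype.card_fin] at h
    omega
  obtain ⟨d', hd'⟩ := exists_hasDistance hne
  obtain ⟨M, hM1, hM2, hM3⟩ := hd'.exists_of_le hdist.pos (hdist.le_of_restrictVec hd')
  rw [hrad] at hM2
  -- The number of ancillas is the dimension of the radical; by `h2` and `h3` it equals `n - k - (2b
  -- - s)`.
  refine ⟨hsb, finrank (ZMod 2) ((labels S).comap (extendVec e)), ?_⟩
  refine exists_isCode ?_ ?_ hM2 hM3
  · rw [Fintype.card_fin]
    omega
  · omega

end EAQ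

theorem corollary4p4 (n k d b s : ℕ)
    (S : Subgroup (EAQ.Op (Fin n))ˣ) (hS : EAQ.IsStabilizerCode S k d)
    (B : Finset (Fin n)) (hB : EAQ.IsCorrectable (EAQ.codespace S) B)
    (hb : B.card = b) (hs : (EAQ.supportedOn S B).ncard = 2 ^ s) :
    s ≤ b ∧ EAQ.ExistsEACode (n - b) k d (b - s) := by
  exact hS.existsEACode hB hb hs

end
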